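/- For $p\in\mathbb{N}_0$ consider on $T^2\times[0,1]$, with coordinates $x,y\in\mathbb{R}/\mathbb{Z}$ and $z\in[0,1]$, the contact form \[ \alpha_p=\sin\Bigl(\tfrac{2p+1}{2}\pi z\Bigr)\,dx+\cos\Bigl(\tfrac{2p+1}{2}\pi z\Bigr)\,dy . \] Collapsing the $x$-circles in $T^2\times\{0\}$ and the $y$-circles in $T^2\times\{1\}$ (contact cut) one obtains $S^3$, oriented by $dx\wedge dy\wedge dz$, with a contact form again denoted by $\alpha_p$; the quotient map to $S^3\subset\mathbb{C}^2$ may be taken to be $(x,y,z)\mapsto(\sqrt{z}\,e^{2\pi i x},\sqrt{1-z}\,e^{2\pi i y})$. The contact structure $\ker\alpha_p$ is oriented by $d\alpha_p$. Let $a,b$ be coprime integers and let $z\in(0,1)$ be such that the characteristic foliation of the torus $T^2\times\{z\}$ has slope $-\tan\bigl(\tfrac{2p+1}{2}\pi z\bigr)=b/a$ (slope $\infty$ if $a=0$). Then \[ \beta_\pm^{a,b}\colon t\longmapsto(\pm at,\pm bt,z),\qquad t\in[0,1], \] are oriented Legendrian knots in $(S^3,\ker\alpha_p)$, and their Thurston--Bennequin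 invariant (the linking number with small push-offs in a direction transverse to $\ker\alpha_p$) and rotation number (the number of rotations of the velocity vector relative to a global positive frame of $\ker\alpha_p$ on $S^3$) are \[ \mathtt{tb}(\beta_\pm^{a,b})=ab,\qquad \mathtt{rot}(\beta_\pm^{a,b})=\pm\bigl(a+(-1)^p b\bigr). \] In particular, with $X_p=\cos\bigl(\tfrac{2p+1}{2}\pi z\bigr)\partial_x-\sin\bigl(\tfrac{2p+1}{2}\pi z\bigr)\partial_y$ and $\varphi=2\pi(x+(-1)^p y)$, the velocity vector of $\beta_\pm^{a,b}$ rotates $\pm(a+(-1)^pb)$ times relative to the frame \[ X_p^1=\cos\varphi\,\partial_z-\sin\varphi\,X_p,\qquad X_p^2=\sin\varphi\,\partial_z+\cos\varphi\,X_p . \] -/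

import Mathlib

open scoped ContDiff Topology ComplexConjugate

namespace ContactCut

noncomputable section

/-! ### The thickened torus with the contact form `α_p`

Points of `T² × [0,1]` are written in lifted coordinates `m = (x, y, z)`, where `x` and `y` are
taken modulo `1`. -/

/-- The angle `(2p+1)π/2 · z`. -/
def angle (p : ℕ) (z : ℝ) : ℝ := (2 * (p : ℝ) + 1) / 2 * Real.pi * z

/-- `α_p = sin((2p+1)πz/2) dx + cos((2p+1)πz/2) dy`, evaluated at `m` on the vector `u`. -/
def alpha (p : ℕ) (m u : ℝ × ℝ × ℝ) : ℝ :=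
  Real.sin (angle p m.2.2) * u.1 + Real.cos (angle p m.2.2) * u.2.1

/-- The differential `dα_p = c cos(cz) dz ∧ dx - c sin(cz) dz ∧ dy`, with `c = (2p+1)π/2`. -/
def dAlpha (p : ℕ) (m u v : ℝ × ℝ × ℝ) : ℝ :=
  angle p 1 * Real.cos (angle p m.2.2) * (u.2.2 * v.1 - v.2.2 * u.1)
    - angle p 1 * Real.sin (angle p m.2.2) * (u.2.2 * v.2.1 - v.2.2 * u.2.1)

/-- The vector field `∂_z`. -/
def dz : ℝ × ℝ × ℝ := (0, 0, 1)

/-- The vector field `X_p = cos((2p+1)πz/2) ∂_x - sin((2p+1)πz/2) ∂_y`. -/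
def X (p : ℕ) (m : ℝ × ℝ × ℝ) : ℝ × ℝ × ℝ :=
  (Real.cos (angle p m.2.2), -Real.sin (angle p m.2.2), 0)

/-- The angle `2π(x + (-1)^p y)` by which the global frame is rotated. -/
def phase (p : ℕ) (m : ℝ × ℝ × ℝ) : ℝ := 2 * Real.pi * (m.1 + (-1) ^ p * m.2.1)

/-- First vector field of the global frame, `cos φ ∂_z - sin φ X_p` with `φ = 2π(x + (-1)^p y)`. -/
def frame₁ (p : ℕ) (m : ℝ × ℝ × ℝ) : ℝ × ℝ × ℝ :=
  Real.cos (phase p m) • dz - Real.sin (phase p m) • X p m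

/-- Second vector field of the global frame, `sin φ ∂_z + cos φ X_p`. -/
def frame₂ (p : ℕ) (m : ℝ × ℝ × ℝ) : ℝ × ℝ × ℝ :=
  Real.sin (phase p m) • dz + Real.cos (phase p m) • X p m

/-- The torus at level `z` has characteristic foliation of slope `-tan((2p+1)πz/2) = b/a`,
where the slope is `∞` exactly if `a = 0`. -/
def HasSlope (p : ℕ) (z : ℝ) (a b : ℤ) : Prop :=
  (a ≠ 0 ∧ Real.cos (angle p z) ≠ 0 ∧ -Real.tan (angle p z) = (b : ℝ) / (a : ℝ)) ∨
    (a = 0 ∧ Real.cos (angle p z) = 0)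

/-! ### The contact cut -/

/-- `S³` as the unit sphere in `ℂ²`, oriented as the boundary of the unit ball. -/
def S3 : Set (ℂ × ℂ) := {w | ‖w.1‖ ^ 2 + ‖w.2‖ ^ 2 = 1}

/-- The quotient map `T² × [0,1] → S³` which collapses the `x`-circles at `z = 0` and the
`y`-circles at `z = 1`. The function `z` is the square of a radial coordinate near either of
the two collapsed tori: this is the smooth structure of the contact cut, in which
the Hamiltonian function of the collapsing circle action is a squared radius. -/
def cut (m : ℝ × ℝ × ℝ) : ℂ × ℂ :=
  ((Real.sqrt m.2.2 : ℂ) * Complex.exp (2 * Real.pi * m.1 * Complex.I),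
    (Real.sqrt (1 - m.2.2) : ℂ) * Complex.exp (2 * Real.pi * m.2.1 * Complex.I))

/-- The contact form on `S³` to which `α_p` descends (see `cutForm_pullback`), evaluated at the
point `w` on the tangent vector `v`. -/
def cutForm (p : ℕ) (w v : ℂ × ℂ) : ℝ :=
  angle p 1 / (2 * Real.pi) *
    (Real.sinc (angle p (‖w.1‖ ^ 2)) * (conj w.1 * v.1).im
      + (-1) ^ p * (Real.sinc (angle p (‖w.2‖ ^ 2)) * (conj w.2 * v.2).im))

/-- `v` is tangent to `S³` at `w`. -/
def IsTangent (w v : ℂ × ℂ) : Prop := (conj w.1 * v.1).re + (conj w.2 * v.2).re = 0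

/-- The contact plane `ker α_p ⊆ T_w S³`. -/
def contactPlane (p : ℕ) (w : ℂ × ℂ) : Set (ℂ × ℂ) := {v | IsTangent w v ∧ cutForm p w v = 0}

/-- The determinant of four vectors of `ℂ² = ℝ⁴`. A basis `(e₁, e₂, e₃)` of `T_w S³` is positive
if `0 < det4 w e₁ e₂ e₃` (outward normal first). -/
def det4 (w e₁ e₂ e₃ : ℂ × ℂ) : ℝ :=
  Matrix.det !![w.1.re, w.1.im, w.2.re, w.2.im;
    e₁.1.re, e₁.1.im, e₁.2.re, e₁.2.im;
    e₂.1.re, e₂.1.im, e₂.2.re, e₂.2.im;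
    e₃.1.re, e₃.1.im, e₃.2.re, e₃.2.im]

/-- Radial projection to `S³`. -/
def normalize (w : ℂ × ℂ) : ℂ × ℂ := (Real.sqrt (‖w.1‖ ^ 2 + ‖w.2‖ ^ 2))⁻¹ • w

/-! ### Winding numbers, linking numbers, and the classical invariants

Closed curves are `1`-periodic functions on `ℝ`. -/

/-- The `1`-periodic loop `f` in `ℂ ∖ {0}` has winding number `n` about `0`: it has a continuous
angle function, which increases by `2πn` over one period. -/
def HasWindingNumber (f : ℝ → ℂ) (n : ℤ) : Prop :=
  ∃ θ : ℝ → ℝ, Continuous θ ∧ (∀ t, f t ≠ 0) ∧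
    (∀ t, f t = (‖f t‖ : ℂ) * Complex.exp (2 * Real.pi * θ t * Complex.I)) ∧
    ∀ t, θ (t + 1) = θ t + n

/-- `γ` is a smooth oriented knot in `S³`, parametrised by `ℝ/ℤ`. -/
structure IsKnot (γ : ℝ → ℂ × ℂ) : Prop where
  smooth : ContDiff ℝ ∞ γ
  mem : ∀ t, γ t ∈ S3
  periodic : Function.Periodic γ 1
  injective : Set.InjOn γ (Set.Ico 0 1)
  immersed : ∀ t, deriv γ t ≠ 0

/-- `γ` is an oriented Legendrian knot in `(S³, ker α_p)`. -/
structure IsLegendrianKnot (p : ℕ) (γ : ℝ → ℂ × ℂ) : Prop extends IsKnot γ where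
  legendrian : ∀ t, deriv γ t ∈ contactPlane p (γ t)

/-- The meridian loop `s ↦ γ(t) + ε (cos(2πs) e₁ + sin(2πs) e₂)`, projected to `S³`. -/
def meridian (γ : ℝ → ℂ × ℂ) (t : ℝ) (e₁ e₂ : ℂ × ℂ) (ε s : ℝ) : ℂ × ℂ :=
  normalize (γ t + ε • (Real.cos (2 * Real.pi * s) • e₁ + Real.sin (2 * Real.pi * s) • e₂))

/-- `F / |F| : S³ ∖ γ → S¹` represents the generator of
`H¹(S³ ∖ γ; ℤ) = [S³ ∖ γ, S¹] ≅ ℤ` which takes the value `1` on positive meridians of the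
oriented knot `γ`. The meridian in the normal directions `e₁`, `e₂` is positive if
`(γ', e₁, e₂)` is a positive basis of the tangent space of `S³`. -/
structure IsMeridianGenerator (γ : ℝ → ℂ × ℂ) (F : ℂ × ℂ → ℂ) : Prop where
  continuousOn : ContinuousOn F (S3 \ Set.range γ)
  ne_zero : ∀ w ∈ S3 \ Set.range γ, F w ≠ 0
  meridian : ∀ t e₁ e₂, IsTangent (γ t) e₁ → IsTangent (γ t) e₂ →
    0 < det4 (γ t) (deriv γ t) e₁ e₂ →
    ∀ᶠ ε in 𝓝[>] (0 : ℝ), HasWindingNumber (fun s => F (meridian γ t e₁ e₂ ε s)) 1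

/-- The closed curve `σ` in `S³ ∖ γ` has linking number `n` with the knot `γ`, i.e. the
isomorphism `H₁(S³ ∖ γ) ≅ ℤ` sending positive meridians of `γ` to `1` sends the class of `σ`
to `n`. -/
def HasLinkingNumber (γ σ : ℝ → ℂ × ℂ) (n : ℤ) : Prop :=
  Continuous σ ∧ Function.Periodic σ 1 ∧ (∀ t, σ t ∈ S3 \ Set.range γ) ∧
    ∃ F : ℂ × ℂ → ℂ, IsMeridianGenerator γ F ∧ HasWindingNumber (fun t => F (σ t)) n

/-- `ν` is a vector field on `S³` along the closed curve `γ`, transverse to `ker α_p`. -/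
structure IsTransverseField (p : ℕ) (γ ν : ℝ → ℂ × ℂ) : Prop where
  continuous : Continuous ν
  periodic : Function.Periodic ν 1
  tangent : ∀ t, IsTangent (γ t) (ν t)
  transverse : ∀ t, cutForm p (γ t) (ν t) ≠ 0

/-- The push-off of `γ` by `ε` in the direction of `ν`. -/
def pushOff (γ ν : ℝ → ℂ × ℂ) (ε t : ℝ) : ℂ × ℂ := normalize (γ t + ε • ν t)

/-- The Legendrian knot `γ` has Thurston–Bennequin invariant `n`: the linking number of `γ` with
small push-offs in directions transverse to `ker α_p` is `n`. -/
def HasThurstonBennequin (p : ℕ) (γ : ℝ → ℂ × ℂ) (n : ℤ) : Prop :=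
  (∃ ν, IsTransverseField p γ ν) ∧
    ∀ ν, IsTransverseField p γ ν →
      ∀ᶠ ε in 𝓝[>] (0 : ℝ), HasLinkingNumber γ (pushOff γ ν ε) n

/-- `(Y₁, Y₂)` is a (continuous) global frame of `ker α_p` on `S³`, positive for the orientation
of `ker α_p` given by `dα_p`. Positivity is expressed in the coordinates `(x, y, z)`, `0 < z < 1`,
on a dense subset of `S³`. -/
structure IsPositiveFrame (p : ℕ) (Y₁ Y₂ : ℂ × ℂ → ℂ × ℂ) : Prop where
  continuousOn₁ : ContinuousOn Y₁ S3
  continuousOn₂ : ContinuousOn Y₂ S3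
  mem₁ : ∀ w ∈ S3, Y₁ w ∈ contactPlane p w
  mem₂ : ∀ w ∈ S3, Y₂ w ∈ contactPlane p w
  independent : ∀ w ∈ S3, LinearIndependent ℝ ![Y₁ w, Y₂ w]
  positive : ∀ m : ℝ × ℝ × ℝ, 0 < m.2.2 → m.2.2 < 1 → ∀ u₁ u₂,
    fderiv ℝ cut m u₁ = Y₁ (cut m) → fderiv ℝ cut m u₂ = Y₂ (cut m) → 0 < dAlpha p m u₁ u₂

/-- The vectors `v t` rotate `n` times relative to the frames `(Y₁ t, Y₂ t)` as `t` traverses one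
period. -/
def RotatesRelativeTo {E : Type*} [AddCommGroup E] [Module ℝ E] (v Y₁ Y₂ : ℝ → E) (n : ℤ) :
    Prop :=
  ∃ f : ℝ → ℂ, (∀ t, v t = (f t).re • Y₁ t + (f t).im • Y₂ t) ∧ HasWindingNumber f n

/-- The Legendrian knot `γ` has rotation number `n`: its velocity vector rotates `n` times
relative to positive global frames of `ker α_p`. -/
def HasRotationNumber (p : ℕ) (γ : ℝ → ℂ × ℂ) (n : ℤ) : Prop :=
  (∃ Y₁ Y₂, IsPositiveFrame p Y₁ Y₂) ∧
    ∀ Y₁ Y₂, IsPositiveFrame p Y₁ Y₂ →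
      RotatesRelativeTo (deriv γ) (fun t => Y₁ (γ t)) (fun t => Y₂ (γ t)) n

/-- The curve `t ↦ (at, bt, z)` on the torus at level `z`. -/
def torusCurve (a b : ℤ) (z t : ℝ) : ℝ × ℝ × ℝ := (a * t, b * t, z)

/-- The closed curve in `S³` given by `t ↦ (at, bt, z)`. -/
def torusKnot (a b : ℤ) (z t : ℝ) : ℂ × ℂ := cut (torusCurve a b z t)

/-! ### Consistency of the model -/

theorem norm_exp_two_pi (r : ℝ) : ‖Complex.exp (2 * Real.pi * r * Complex.I)‖ = 1 := by
  have := Complex.norm_exp_ofReal_mul_I (2 * Real.pi * r)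
  push_cast at this
  exact this

theorem cut_mem (x y z : ℝ) (h0 : 0 ≤ z) (h1 : z ≤ 1) : cut (x, y, z) ∈ S3 := by
  have e := norm_exp_two_pi
  simp only [S3, cut, Set.mem_ofPred_eq, norm_mul, e, Complex.norm_real, mul_one, Real.norm_eq_abs,
    sq_abs]
  rw [Real.sq_sqrt h0, Real.sq_sqrt (by linarith)]
  ring

theorem exists_polar (w : ℂ) : ∃ x : ℝ, w = (‖w‖ : ℂ) * Complex.exp (2 * Real.pi * x * Complex.I) := by
  refine ⟨w.arg / (2 * Real.pi), ?_⟩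
  have h : (2 * Real.pi * ((w.arg / (2 * Real.pi) : ℝ) : ℂ)) = (w.arg : ℂ) := by
    have : (Real.pi : ℂ) ≠ 0 := by exact_mod_cast Real.pi_ne_zero
    push_cast
    field_simp
  rw [h, Complex.norm_mul_exp_arg_mul_I]

/-- Every point of `S³` is the image of a point of `T² × [0,1]`. -/
theorem cut_surjective (w : ℂ × ℂ) (hw : w ∈ S3) :
    ∃ x y z, 0 ≤ z ∧ z ≤ 1 ∧ cut (x, y, z) = w := by
  obtain ⟨x, hx⟩ := exists_polar w.1
  obtain ⟨y, hy⟩ := exists_polar w.2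
  have hw' : ‖w.1‖ ^ 2 + ‖w.2‖ ^ 2 = 1 := hw
  refine ⟨x, y, ‖w.1‖ ^ 2, by positivity, by nlinarith [sq_nonneg ‖w.2‖], ?_⟩
  have h2 : 1 - ‖w.1‖ ^ 2 = ‖w.2‖ ^ 2 := by linarith
  ext1
  · simp only [cut, Real.sqrt_sq (norm_nonneg _)]
    exact hx.symm
  · simp only [cut, h2, Real.sqrt_sq (norm_nonneg _)]
    exact hy.symm

theorem polar_eq_iff (r s x x' : ℝ) (hr : 0 ≤ r) (hs : 0 ≤ s) :
    (r : ℂ) * Complex.exp (2 * Real.pi * x * Complex.I)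
        = (s : ℂ) * Complex.exp (2 * Real.pi * x' * Complex.I) ↔
      r = s ∧ (r = 0 ∨ ∃ k : ℤ, x = x' + k) := by
  have e := norm_exp_two_pi
  have key : Complex.exp (2 * Real.pi * x * Complex.I) = Complex.exp (2 * Real.pi * x' * Complex.I)
      ↔ ∃ k : ℤ, x = x' + k := by
    rw [Complex.exp_eq_exp_iff_exists_int]
    refine exists_congr fun k => ?_
    have hpi : (2 * Real.pi * Complex.I : ℂ) ≠ 0 := Complex.two_pi_I_ne_zero
    constructor
    · intro h
      have h' : (2 * Real.pi * Complex.I : ℂ) * x = (2 * Real.pi * Complex.I) * (x' + k) := by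
        linear_combination h
      have := mul_left_cancel₀ hpi h'
      exact_mod_cast this
    · rintro rfl
      push_cast
      ring
  constructor
  · intro h
    have hn := congrArg norm h
    simp only [norm_mul, e, Complex.norm_real, mul_one, Real.norm_eq_abs, abs_of_nonneg hr,
      abs_of_nonneg hs] at hn
    refine ⟨hn, ?_⟩
    by_cases h0 : r = 0
    · exact Or.inl h0
    · right
      subst hn
      exact key.1 (mul_left_cancel₀ (by exact_mod_cast h0) h)
  · rintro ⟨rfl, h | h⟩
    · simp [h]
    · rw [key.2 h]

/-- Two points of `T² × [0,1]` are identified in `S³` precisely if they lie on the same collapsed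
circle. -/
theorem cut_eq_cut_iff (x y z x' y' z' : ℝ) (h0 : 0 ≤ z) (h1 : z ≤ 1) (h0' : 0 ≤ z')
    (h1' : z' ≤ 1) :
    cut (x, y, z) = cut (x', y', z') ↔
      z = z' ∧ (z = 0 ∨ ∃ k : ℤ, x = x' + k) ∧ (z = 1 ∨ ∃ k : ℤ, y = y' + k) := by
  simp only [cut, Prod.mk.injEq]
  rw [polar_eq_iff _ _ _ _ (Real.sqrt_nonneg _) (Real.sqrt_nonneg _),
    polar_eq_iff _ _ _ _ (Real.sqrt_nonneg _) (Real.sqrt_nonneg _), Real.sqrt_inj h0 h0',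
    Real.sqrt_eq_zero h0, Real.sqrt_inj (by linarith) (by linarith),
    Real.sqrt_eq_zero (by linarith)]
  constructor
  · rintro ⟨⟨h, hx⟩, -, hy⟩
    exact ⟨h, hx, hy.imp (fun h => by linarith) id⟩
  · rintro ⟨h, hx, hy⟩
    exact ⟨⟨h, hx⟩, by linarith, hy.imp (fun h => by linarith) id⟩

/-- The differential of `cut` at `(x, y, z)`, `0 < z < 1`. -/
theorem fderiv_cut (x y z : ℝ) (h0 : 0 < z) (h1 : z < 1) (u : ℝ × ℝ × ℝ) :
    fderiv ℝ cut (x, y, z) u =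
      (((u.2.2 / (2 * Real.sqrt z) : ℝ) + (2 * Real.pi * Real.sqrt z * u.1 : ℝ) * Complex.I)
          * Complex.exp (2 * Real.pi * x * Complex.I),
        (-(u.2.2 / (2 * Real.sqrt (1 - z)) : ℝ)
            + (2 * Real.pi * Real.sqrt (1 - z) * u.2.1 : ℝ) * Complex.I)
          * Complex.exp (2 * Real.pi * y * Complex.I)) := by
  have hd : DifferentiableAt ℝ cut (x, y, z) := by
    unfold cut
    refine DifferentiableAt.prodMk ?_ ?_
    · refine DifferentiableAt.mul ?_ (by fun_prop)
      exact Complex.ofRealCLM.differentiableAt.comp _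
        (DifferentiableAt.sqrt (by fun_prop) (by simpa using h0.ne'))
    · refine DifferentiableAt.mul ?_ (by fun_prop)
      exact Complex.ofRealCLM.differentiableAt.comp _
        (DifferentiableAt.sqrt (by fun_prop) (by simpa using (sub_pos.2 h1).ne'))
  rw [← hd.lineDeriv_eq_fderiv]
  refine HasLineDerivAt.lineDeriv (v := u) ?_
  have lin : ∀ c d : ℝ, HasDerivAt (fun t : ℝ => c + t * d) d 0 := fun c d => by
    simpa using ((hasDerivAt_id (0 : ℝ)).mul_const d).const_add c
  have ex : ∀ c d : ℝ, HasDerivAt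
      (fun t : ℝ => Complex.exp (2 * Real.pi * ((c + t * d : ℝ) : ℂ) * Complex.I))
      (Complex.exp (2 * Real.pi * c * Complex.I) * (2 * Real.pi * d * Complex.I)) 0 := fun c d => by
    have := ((((lin c d).ofReal_comp).const_mul (2 * Real.pi : ℂ)).mul_const Complex.I).cexp
    simpa using this
  have s1 : HasDerivAt (fun t : ℝ => ((Real.sqrt (z + t * u.2.2) : ℝ) : ℂ))
      ((u.2.2 / (2 * Real.sqrt z) : ℝ) : ℂ) 0 := by
    have := ((lin z u.2.2).sqrt (by simpa using h0.ne')).ofReal_comp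
    simpa using this
  have s2 : HasDerivAt (fun t : ℝ => ((Real.sqrt (1 - (z + t * u.2.2)) : ℝ) : ℂ))
      ((-u.2.2 / (2 * Real.sqrt (1 - z)) : ℝ) : ℂ) 0 := by
    have := (((lin z u.2.2).const_sub 1).sqrt (by simpa using (sub_pos.2 h1).ne')).ofReal_comp
    simpa using this
  have h := (s1.fun_mul (ex x u.1)).prodMk (s2.fun_mul (ex y u.2.1))
  refine HasDerivAt.congr_deriv (f := fun t : ℝ => cut ((x, y, z) + t • u)) h ?_
  ext1
  · simp
    ring
  · simp
    ring

theorem conj_mul_polar (r x : ℝ) (c : ℂ) :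
    conj ((r : ℂ) * Complex.exp (2 * Real.pi * x * Complex.I))
        * (c * Complex.exp (2 * Real.pi * x * Complex.I)) = r * c := by
  have h : conj (Complex.exp (2 * Real.pi * x * Complex.I))
      * Complex.exp (2 * Real.pi * x * Complex.I) = 1 := by
    have h2 : conj (2 : ℂ) = 2 := Complex.conj_ofNat 2
    rw [← Complex.exp_conj, ← Complex.exp_add]
    simp [h2]
  rw [map_mul, Complex.conj_ofReal]
  linear_combination ((r : ℂ) * c) * h

theorem angle_ne_zero (p : ℕ) {z : ℝ} (hz : z ≠ 0) : angle p z ≠ 0 := by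
  unfold angle
  have : (2 * (p : ℝ) + 1) / 2 * Real.pi > 0 := by positivity
  exact mul_ne_zero this.ne' hz

theorem sin_angle_one_sub (p : ℕ) (z : ℝ) :
    Real.sin (angle p (1 - z)) = (-1) ^ p * Real.cos (angle p z) := by
  have h : angle p (1 - z) = (Real.pi / 2 - angle p z) + p * Real.pi := by
    unfold angle
    ring
  rw [h, Real.sin_add_nat_mul_pi, Real.sin_pi_div_two_sub]

/-- `cutForm p` pulls back to `α_p` on the open dense part `T² × (0,1)`. -/
theorem cutForm_pullback (p : ℕ) (x y z : ℝ) (h0 : 0 < z) (h1 : z < 1) (u : ℝ × ℝ × ℝ) :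
    cutForm p (cut (x, y, z)) (fderiv ℝ cut (x, y, z) u) = alpha p (x, y, z) u := by
  have e := norm_exp_two_pi
  have h1' : 0 < 1 - z := by linarith
  have q1 : Real.sqrt z * Real.sqrt z = z := Real.mul_self_sqrt h0.le
  have q2 : Real.sqrt (1 - z) * Real.sqrt (1 - z) = 1 - z := Real.mul_self_sqrt h1'.le
  have i1 : ∀ r s t : ℝ, ((r : ℂ) * ((s : ℂ) + (t : ℂ) * Complex.I)).im = r * t := by
    intro r s t
    simp
  rw [fderiv_cut x y z h0 h1 u]
  unfold cutForm cut
  simp only [conj_mul_polar, norm_mul, e, Complex.norm_real, mul_one, Real.norm_eq_abs, sq_abs,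
    Real.sq_sqrt h0.le, Real.sq_sqrt h1'.le]
  rw [← Complex.ofReal_neg, i1, i1,
    Real.sinc_of_ne_zero (angle_ne_zero p h0.ne'), Real.sinc_of_ne_zero (angle_ne_zero p h1'.ne'),
    sin_angle_one_sub]
  have hs : ((-1 : ℝ) ^ p) * (-1) ^ p = 1 := by
    rw [← mul_pow]
    simp
  have a1 : angle p z = angle p 1 * z := by
    unfold angle
    ring
  have a2 : angle p (1 - z) = angle p 1 * (1 - z) := by
    unfold angle
    ring
  have a0 := angle_ne_zero p one_ne_zero
  have hpi := Real.pi_ne_zero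
  have t1 : angle p 1 / (2 * Real.pi) * (Real.sin (angle p z) / angle p z
      * (Real.sqrt z * (2 * Real.pi * Real.sqrt z * u.1))) = Real.sin (angle p z) * u.1 := by
    rw [show Real.sqrt z * (2 * Real.pi * Real.sqrt z * u.1) = 2 * Real.pi * z * u.1 by
      linear_combination (2 * Real.pi * u.1) * q1]
    generalize Real.sin (angle p z) = S
    rw [a1]
    field_simp
  have t2 : angle p 1 / (2 * Real.pi) * ((-1) ^ p * ((-1) ^ p * Real.cos (angle p z)
      / angle p (1 - z) * (Real.sqrt (1 - z) * (2 * Real.pi * Real.sqrt (1 - z) * u.2.1))))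
      = Real.cos (angle p z) * u.2.1 := by
    rw [show Real.sqrt (1 - z) * (2 * Real.pi * Real.sqrt (1 - z) * u.2.1)
      = 2 * Real.pi * (1 - z) * u.2.1 by linear_combination (2 * Real.pi * u.2.1) * q2]
    generalize Real.cos (angle p z) = C
    rw [a2]
    have := h1'.ne'
    field_simp
    linear_combination C * u.2.1 * hs
  unfold alpha
  rw [mul_add, t1, t2]

/-- The coordinates `(x, y, z)` are positive for the orientation of `S³`. -/
theorem det4_pos (x y z : ℝ) (h0 : 0 < z) (h1 : z < 1) :
    0 < det4 (cut (x, y, z)) (fderiv ℝ cut (x, y, z) (1, 0, 0)) (fderiv ℝ cut (x, y, z) (0, 1, 0))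
      (fderiv ℝ cut (x, y, z) (0, 0, 1)) := by
  have e : ∀ r : ℝ, ∃ c s : ℝ, c ^ 2 + s ^ 2 = 1 ∧
      Complex.exp (2 * Real.pi * r * Complex.I) = (⟨c, s⟩ : ℂ) := fun r => by
    refine ⟨Real.cos (2 * Real.pi * r), Real.sin (2 * Real.pi * r), Real.cos_sq_add_sin_sq _, ?_⟩
    have : (2 * Real.pi * r * Complex.I : ℂ) = ((2 * Real.pi * r : ℝ) : ℂ) * Complex.I := by
      push_cast
      ring
    rw [this]
    exact Complex.ext (Complex.exp_ofReal_mul_I_re _) (Complex.exp_ofReal_mul_I_im _)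
  obtain ⟨c, s, hcs, hc⟩ := e x
  obtain ⟨c', s', hcs', hc'⟩ := e y
  have h1' : 0 < 1 - z := by linarith
  have g1 : 0 < Real.sqrt z := Real.sqrt_pos.2 h0
  have g2 : 0 < Real.sqrt (1 - z) := Real.sqrt_pos.2 h1'
  have q : Real.sqrt z ^ 2 + Real.sqrt (1 - z) ^ 2 = 1 := by
    rw [Real.sq_sqrt h0.le, Real.sq_sqrt h1'.le]
    ring
  simp only [fderiv_cut x y z h0 h1, cut, hc, hc']
  generalize Real.sqrt z = A at *
  generalize Real.sqrt (1 - z) = B at *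
  have : (0 : ℝ) < 2 * Real.pi ^ 2 := by positivity
  convert this using 1
  simp [det4, Matrix.det_succ_row_zero, Fin.sum_univ_succ, Fin.succAbove]
  field_simp
  have k : (c ^ 2 + s ^ 2) * (c' ^ 2 + s' ^ 2) * (A ^ 2 + B ^ 2) = 1 := by
    rw [hcs, hcs', q]
    norm_num
  linear_combination k

end

end ContactCut

open ContactCut

/-! By the slope condition (a, b) = k (cos, −sin) with k ≠ 0, so the curve is tangent to X_p, and
coprimality makes it an embedded torus knot. Both invariants are then computed as winding numbers of
explicit maps.

Thurston–Bennequin invariant. The function F = w₁^b/|γ₁|^b − w₂^a/|γ₂|^a (`knotFun`, with conjugates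
for negative exponents) vanishes on S³ exactly along the knot (`mem_range_of_knotFun_eq_zero`), and
its derivative normal to the knot preserves orientation, so F/|F| measures linking
(`isMeridianGenerator_knotFun`). On a tangent field ν along the knot, dF(ν) = e^{2πiabt}(ρ + iτ)
with τ = −2πk α_p(ν) (`fderiv_knotFun_normalize`). If ν is transverse, τ has no zero, so ρ + iτ does
not wind and the total winding is ab; `hasWindingNumber_near_zeros` carries this over to small
push-offs.

Rotation number. `frameVec` identifies all contact planes continuously with ℂ, and the velocity
corresponds to a constant times e^{2πi(a+(−1)^p b)t} (`deriv_torusKnot_eq_frameVec`). Any other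
positive frame differs by an orientation-preserving matrix function on all of S³. It can only change
the count by the winding of a nonvanishing function on S³ along the knot, and this is zero because
the knot contracts in S³ (`hasWindingNumber_comp_torusKnot`). -/

namespace ContactCut

/-! ### Winding numbers -/

/-- The point `e^{2πix}` of the unit circle. -/
noncomputable def circ (x : ℝ) : ℂ := Complex.exp (2 * Real.pi * x * Complex.I)

theorem norm_circ (x : ℝ) : ‖circ x‖ = 1 := norm_exp_two_pi x

theorem circ_ne_zero (x : ℝ) : circ x ≠ 0 := Complex.exp_ne_zero _

theorem circ_add (x y : ℝ) : circ (x + y) = circ x * circ y := by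
  unfold circ
  rw [← Complex.exp_add]
  push_cast
  ring_nf

theorem circ_zero : circ 0 = 1 := by simp [circ]

theorem circ_int (n : ℤ) : circ n = 1 := by
  unfold circ
  rw [Complex.exp_eq_one_iff]
  exact ⟨n, by push_cast; ring⟩

theorem circ_neg (x : ℝ) : circ (-x) = conj (circ x) := by
  unfold circ
  rw [← Complex.exp_conj]
  simp [Complex.conj_ofNat]

theorem conj_circ_mul (x : ℝ) : conj (circ x) * circ x = 1 := by
  rw [← circ_neg, ← circ_add, neg_add_cancel, circ_zero]

theorem circ_pow (x : ℝ) (n : ℕ) : circ x ^ n = circ (n * x) := by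
  unfold circ
  rw [← Complex.exp_nat_mul]
  push_cast
  ring_nf

theorem contDiff_circ {n : WithTop ℕ∞} : ContDiff ℝ n circ := by
  have : circ = fun x : ℝ => Complex.exp (2 * Real.pi * Complex.ofRealCLM x * Complex.I) := rfl
  rw [this]
  fun_prop

@[fun_prop]
theorem continuous_circ : Continuous circ := contDiff_circ (n := 0).continuous

theorem hasDerivAt_circ (x : ℝ) : HasDerivAt circ (2 * Real.pi * Complex.I * circ x) x := by
  have := (((hasDerivAt_id x).ofReal_comp.const_mul (2 * Real.pi : ℂ)).mul_const Complex.I).cexp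
  refine this.congr_deriv ?_
  simp only [circ, id]
  push_cast
  ring

theorem periodic_circ_int_mul (n : ℤ) : Function.Periodic (fun t : ℝ => circ (n * t)) 1 := by
  intro t
  simp only [mul_add, mul_one, circ_add, circ_int]

theorem circ_re (x : ℝ) : (circ x).re = Real.cos (2 * Real.pi * x) := by
  have : (2 * Real.pi * x * Complex.I : ℂ) = ((2 * Real.pi * x : ℝ) : ℂ) * Complex.I := by
    push_cast
    ring
  rw [circ, this, Complex.exp_ofReal_mul_I_re]

theorem circ_im (x : ℝ) : (circ x).im = Real.sin (2 * Real.pi * x) := by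
  have : (2 * Real.pi * x * Complex.I : ℂ) = ((2 * Real.pi * x : ℝ) : ℂ) * Complex.I := by
    push_cast
    ring
  rw [circ, this, Complex.exp_ofReal_mul_I_im]

theorem HasWindingNumber.mul {f g : ℝ → ℂ} {n m : ℤ} (hf : HasWindingNumber f n)
    (hg : HasWindingNumber g m) : HasWindingNumber (fun t => f t * g t) (n + m) := by
  obtain ⟨θ, hθ, f0, hfθ, hθ1⟩ := hf
  obtain ⟨η, hη, g0, hgη, hη1⟩ := hg
  refine ⟨fun t => θ t + η t, hθ.add hη, fun t => mul_ne_zero (f0 t) (g0 t), fun t => ?_,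
    fun t => ?_⟩
  · have h := circ_add (θ t) (η t)
    unfold circ at h
    rw [h, norm_mul]
    push_cast
    linear_combination g t * hfθ t + ((‖f t‖ : ℂ) * Complex.exp (2 * Real.pi * θ t * Complex.I))
      * hgη t
  · simp only [hθ1, hη1]
    push_cast
    ring

theorem hasWindingNumber_circ (n : ℤ) : HasWindingNumber (fun t => circ (n * t)) n := by
  refine ⟨fun t => n * t, by fun_prop, fun t => circ_ne_zero _, fun t => ?_, fun t => by ring⟩
  rw [norm_circ]
  simp [circ]

/-- The principal argument is continuous on the slit plane, so it serves as an angle function, and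
it is periodic because f is. -/
theorem hasWindingNumber_of_mem_slitPlane {f : ℝ → ℂ} (hf : Continuous f)
    (hper : Function.Periodic f 1) (h : ∀ t, f t ∈ Complex.slitPlane) : HasWindingNumber f 0 := by
  refine ⟨fun t => (f t).arg / (2 * Real.pi), ?_, fun t => Complex.slitPlane_ne_zero (h t),
    fun t => ?_, fun t => by simp [hper t]⟩
  · refine Continuous.div_const (continuous_iff_continuousAt.2 fun t => ?_) _
    exact (Complex.continuousAt_arg (h t)).comp hf.continuousAt
  · have hpi : (Real.pi : ℂ) ≠ 0 := by exact_mod_cast Real.pi_ne_zero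
    have : (2 * Real.pi * (((f t).arg / (2 * Real.pi) : ℝ) : ℂ)) = ((f t).arg : ℂ) := by
      push_cast
      field_simp
    rw [this, Complex.norm_mul_exp_arg_mul_I]

/-- Treated separately because c may lie on the negative real axis, outside the slit plane. -/
theorem hasWindingNumber_const {c : ℂ} (hc : c ≠ 0) : HasWindingNumber (fun _ => c) 0 := by
  refine ⟨fun _ => c.arg / (2 * Real.pi), continuous_const, fun _ => hc, fun t => ?_,
    fun t => by simp⟩
  have hpi : (Real.pi : ℂ) ≠ 0 := by exact_mod_cast Real.pi_ne_zero
  have : (2 * Real.pi * ((c.arg / (2 * Real.pi) : ℝ) : ℂ)) = (c.arg : ℂ) := by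
    push_cast
    field_simp
  rw [this, Complex.norm_mul_exp_arg_mul_I]

theorem HasWindingNumber.const_mul {f : ℝ → ℂ} {n : ℤ} (hf : HasWindingNumber f n) {c : ℂ}
    (hc : c ≠ 0) : HasWindingNumber (fun t => c * f t) n := by
  simpa using (hasWindingNumber_const hc).mul hf

theorem HasWindingNumber.pos_mul {f : ℝ → ℂ} {n : ℤ} (hf : HasWindingNumber f n) {r : ℝ → ℝ}
    (hr : ∀ t, 0 < r t) : HasWindingNumber (fun t => (r t : ℂ) * f t) n := by
  obtain ⟨θ, hθ, f0, hfθ, hθ1⟩ := hf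
  refine ⟨θ, hθ, fun t => mul_ne_zero (by exact_mod_cast (hr t).ne') (f0 t), fun t => ?_, hθ1⟩
  rw [norm_mul, Complex.norm_real, Real.norm_of_nonneg (hr t).le]
  push_cast
  linear_combination (r t : ℂ) * hfθ t

theorem HasWindingNumber.conj {f : ℝ → ℂ} {n : ℤ} (hf : HasWindingNumber f n) :
    HasWindingNumber (fun t => conj (f t)) (-n) := by
  obtain ⟨θ, hθ, f0, hfθ, hθ1⟩ := hf
  refine ⟨fun t => -θ t, hθ.neg, fun t => by simpa using f0 t, fun t => ?_, fun t => ?_⟩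
  · have h := circ_neg (θ t)
    unfold circ at h
    rw [h, RCLike.norm_conj]
    simpa only [map_mul, Complex.conj_ofReal] using congrArg (starRingEnd ℂ) (hfθ t)
  · simp only [hθ1]
    push_cast
    ring

/-- Rouché's principle for winding numbers. -/
theorem HasWindingNumber.of_norm_sub_lt {f g : ℝ → ℂ} {n : ℤ} (h : HasWindingNumber f n)
    (hf : Continuous f) (hg : Continuous g) (pf : Function.Periodic f 1)
    (pg : Function.Periodic g 1) (hfg : ∀ t, ‖g t - f t‖ < ‖f t‖) : HasWindingNumber g n := by
  have f0 : ∀ t, f t ≠ 0 := h.choose_spec.2.1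
  -- The quotient stays within distance 1 of 1, hence in the right half-plane.
  have hu : HasWindingNumber (fun t => g t / f t) 0 := by
    refine hasWindingNumber_of_mem_slitPlane (hg.div hf f0) (fun t => by simp only [pf t, pg t])
      fun t => ?_
    have h1 : ‖g t / f t - 1‖ < 1 := by
      rw [div_sub_one (f0 t), norm_div, div_lt_one (norm_pos_iff.2 (f0 t))]
      exact hfg t
    left
    have h2 := (abs_lt.1 ((Complex.abs_re_le_norm _).trans_lt h1)).1
    simp only [Complex.sub_re, Complex.one_re] at h2
    linarith
  have := h.mul hu
  rw [add_zero] at this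
  convert this using 2 with t
  field_simp [f0 t]

/-- Homotopy invariance of winding numbers. -/
theorem HasWindingNumber.homotopy {H : ℝ → ℝ → ℂ} {n : ℤ}
    (hH : Continuous fun q : ℝ × ℝ => H q.1 q.2) (h0 : ∀ s t, H s t ≠ 0)
    (hper : ∀ s, Function.Periodic (H s) 1) {s₀ : ℝ} (h : HasWindingNumber (H s₀) n) (s₁ : ℝ) :
    HasWindingNumber (H s₁) n := by
  have hc : ∀ s, Continuous (H s) := fun s => hH.comp (by fun_prop : Continuous fun t => (s, t))
  -- Compactness of one period makes the Rouché estimate uniform in t. It is recorded in both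
  -- directions: one gives openness of the set of good s, the other openness of its complement.
  have near : ∀ s, ∀ᶠ s' in 𝓝 s, ∀ t, ‖H s' t - H s t‖ < ‖H s t‖ ∧ ‖H s t - H s' t‖ < ‖H s' t‖ := by
    intro s
    have h1 : ∀ t ∈ Set.Icc (0 : ℝ) 1, ∀ᶠ q : ℝ × ℝ in 𝓝 (s, t),
        ‖H q.1 q.2 - H s q.2‖ < ‖H s q.2‖ ∧ ‖H s q.2 - H q.1 q.2‖ < ‖H q.1 q.2‖ := by
      intro t _
      have c2 : Continuous fun q : ℝ × ℝ => H s q.2 := (hc s).comp continuous_snd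
      have hpos : 0 < ‖H s t‖ := norm_pos_iff.2 (h0 s t)
      refine Filter.Eventually.and ?_ ?_
      · exact (isOpen_lt (hH.sub c2).norm c2.norm).mem_nhds (by simpa using hpos)
      · exact (isOpen_lt (c2.sub hH).norm hH.norm).mem_nhds (by simpa using hpos)
    filter_upwards [isCompact_Icc.eventually_forall_of_forall_eventually (P := fun s' t =>
      ‖H s' t - H s t‖ < ‖H s t‖ ∧ ‖H s t - H s' t‖ < ‖H s' t‖) h1] with s' hs' t
    have := hs' (Int.fract t) ⟨Int.fract_nonneg t, (Int.fract_lt_one t).le⟩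
    have key : ∀ s, H s (Int.fract t) = H s t := fun s => by
      simpa using (hper s).sub_int_mul_eq (x := t) ⌊t⌋
    simpa only [key] using this
  have hopen : IsOpen {s | HasWindingNumber (H s) n} := isOpen_iff_mem_nhds.2 fun s hs => by
    filter_upwards [near s] with s' hs'
    exact HasWindingNumber.of_norm_sub_lt hs (hc s) (hc s') (hper s) (hper s') fun t => (hs' t).1
  have hclosed : IsClosed {s | HasWindingNumber (H s) n} := by
    rw [← isOpen_compl_iff, isOpen_iff_mem_nhds]
    intro s hs
    filter_upwards [near s] with s' hs' hw
    exact hs (HasWindingNumber.of_norm_sub_lt hw (hc s') (hc s) (hper s') (hper s)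
      fun t => (hs' t).2)
  have := IsClopen.eq_univ ⟨hclosed, hopen⟩ ⟨s₀, h⟩
  exact (Set.eq_univ_iff_forall.1 this) s₁

/-- The image of the unit circle under an orientation preserving linear map winds once. -/
theorem hasWindingNumber_ellipse {A B : ℂ} (h : 0 < (conj A * B).im) :
    HasWindingNumber (fun s => (Real.cos (2 * Real.pi * s) : ℂ) * A
      + (Real.sin (2 * Real.pi * s) : ℂ) * B) 1 := by
  -- Splitting a real linear map into its complex linear part (A − iB)/2 and its antilinear part (A
  -- + iB)/2, the determinant is positive exactly when the linear part is larger. Rouché then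
  -- compares the ellipse with that part.
  have hd : Complex.normSq (A - Complex.I * B) - Complex.normSq (A + Complex.I * B)
      = 4 * (conj A * B).im := by
    simp [Complex.normSq_apply]
    ring
  have hlt : ‖A + Complex.I * B‖ < ‖A - Complex.I * B‖ := by
    rw [← sq_lt_sq₀ (norm_nonneg _) (norm_nonneg _), ← Complex.normSq_eq_norm_sq,
      ← Complex.normSq_eq_norm_sq]
    linarith
  have hα : (A - Complex.I * B) / 2 ≠ 0 :=
    div_ne_zero (norm_pos_iff.1 ((norm_nonneg _).trans_lt hlt)) two_ne_zero
  have hexp : ∀ s : ℝ, (Real.cos (2 * Real.pi * s) : ℂ) * A + (Real.sin (2 * Real.pi * s) : ℂ) * B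
      = (A - Complex.I * B) / 2 * circ s + (A + Complex.I * B) / 2 * conj (circ s) := fun s => by
    rw [← circ_re, ← circ_im]
    apply Complex.ext <;> simp <;> ring
  have pc : ∀ s, circ (s + 1) = circ s := fun s => by
    have := circ_int 1
    rw [circ_add]
    simp_all
  have hw : HasWindingNumber (fun s => (A - Complex.I * B) / 2 * circ s) 1 := by
    simpa using (hasWindingNumber_circ 1).const_mul hα
  simp only [hexp]
  refine hw.of_norm_sub_lt (by fun_prop) ?_ (fun s => by simp only [pc]) (fun s => by simp only [pc])
    fun s => ?_
  · exact (by fun_prop : Continuous fun s => (A - Complex.I * B) / 2 * circ s).add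
      (continuous_const.mul (Complex.continuous_conj.comp continuous_circ))
  · rw [add_sub_cancel_left, norm_mul, norm_mul, RCLike.norm_conj, norm_circ, norm_div, norm_div]
    simp
    linarith

/-! ### Torus knots -/

theorem cut_eq (x y z : ℝ) :
    cut (x, y, z) = ((Real.sqrt z : ℂ) * circ x, (Real.sqrt (1 - z) : ℂ) * circ y) := rfl

theorem torusKnot_eq (a b : ℤ) (z t : ℝ) :
    torusKnot a b z t = ((Real.sqrt z : ℂ) * circ (a * t), (Real.sqrt (1 - z) : ℂ) * circ (b * t)) :=
  rfl

theorem norm_sqrt_mul_circ {r : ℝ} (hr : 0 ≤ r) (x : ℝ) : ‖(Real.sqrt r : ℂ) * circ x‖ ^ 2 = r := by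
  rw [norm_mul, norm_circ, mul_one, Complex.norm_real, Real.norm_eq_abs, sq_abs, Real.sq_sqrt hr]

/-- Away from the core circles both sinc factors can be written as quotients, and the two signs
(−1)^p cancel. The formula holds for every ambient vector v, so no preimage under `cut` is needed.
-/
theorem cutForm_cut (p : ℕ) (x y z : ℝ) (h0 : 0 < z) (h1 : z < 1) (v : ℂ × ℂ) :
    cutForm p (cut (x, y, z)) v = (2 * Real.pi)⁻¹ *
      (Real.sin (angle p z) / z * (conj (cut (x, y, z)).1 * v.1).im
        + Real.cos (angle p z) / (1 - z) * (conj (cut (x, y, z)).2 * v.2).im) := by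
  have h1' : 0 < 1 - z := by linarith
  have e1 : ‖(cut (x, y, z)).1‖ ^ 2 = z := norm_sqrt_mul_circ h0.le x
  have e2 : ‖(cut (x, y, z)).2‖ ^ 2 = 1 - z := norm_sqrt_mul_circ h1'.le y
  unfold cutForm
  rw [e1, e2, Real.sinc_of_ne_zero (angle_ne_zero p h0.ne'),
    Real.sinc_of_ne_zero (angle_ne_zero p h1'.ne'), sin_angle_one_sub]
  have hs : ((-1 : ℝ) ^ p) * (-1) ^ p = 1 := by
    rw [← mul_pow]
    simp
  have a1 : angle p z = angle p 1 * z := by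
    unfold angle
    ring
  have a2 : angle p (1 - z) = angle p 1 * (1 - z) := by
    unfold angle
    ring
  have a0 := angle_ne_zero p one_ne_zero
  have hpi := Real.pi_ne_zero
  generalize (conj (cut (x, y, z)).1 * v.1).im = s
  generalize (conj (cut (x, y, z)).2 * v.2).im = u
  generalize Real.sin (angle p z) = S
  generalize Real.cos (angle p z) = C
  rw [a1, a2]
  generalize angle p 1 = c at *
  generalize ((-1 : ℝ) ^ p) = κ at *
  have := h1'.ne'
  have := h0.ne'
  field_simp
  linear_combination C * z * u * hs

theorem contDiff_torusKnot (a b : ℤ) (z : ℝ) : ContDiff ℝ ∞ (torusKnot a b z) := by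
  have h : ∀ n : ℤ, ContDiff ℝ ∞ fun t : ℝ => circ (n * t) := fun n =>
    contDiff_circ.comp (contDiff_const.mul contDiff_id)
  have e : torusKnot a b z = fun t : ℝ =>
      ((Real.sqrt z : ℂ) * circ (a * t), (Real.sqrt (1 - z) : ℂ) * circ (b * t)) := rfl
  rw [e]
  exact (contDiff_const.mul (h a)).prodMk (contDiff_const.mul (h b))

theorem continuous_torusKnot (a b : ℤ) (z : ℝ) : Continuous (torusKnot a b z) :=
  (contDiff_torusKnot a b z).continuous

theorem periodic_torusKnot (a b : ℤ) (z : ℝ) : Function.Periodic (torusKnot a b z) 1 := fun t => by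
  have h1 := periodic_circ_int_mul a t
  have h2 := periodic_circ_int_mul b t
  simp only at h1 h2
  rw [torusKnot_eq, torusKnot_eq, h1, h2]

theorem deriv_torusKnot (a b : ℤ) (z t : ℝ) :
    deriv (torusKnot a b z) t = (2 * Real.pi * Complex.I * a * (torusKnot a b z t).1,
      2 * Real.pi * Complex.I * b * (torusKnot a b z t).2) := by
  have h : ∀ (n : ℤ) (r : ℝ), HasDerivAt (fun t : ℝ => (r : ℂ) * circ (n * t))
      (2 * Real.pi * Complex.I * n * (r * circ (n * t))) t := fun n r => by
    have := ((hasDerivAt_circ (n * t)).scomp t ((hasDerivAt_id t).const_mul (n : ℝ))).const_mul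
      (r : ℂ)
    refine this.congr_deriv ?_
    simp
    ring
  have e : HasDerivAt (torusKnot a b z) (2 * Real.pi * Complex.I * a * (torusKnot a b z t).1,
      2 * Real.pi * Complex.I * b * (torusKnot a b z t).2) t :=
    (h a (Real.sqrt z)).prodMk (h b (Real.sqrt (1 - z)))
  exact e.deriv

theorem normSq_torusKnot_fst (a b : ℤ) {z : ℝ} (h0 : 0 ≤ z) (t : ℝ) :
    conj (torusKnot a b z t).1 * (torusKnot a b z t).1 = z := by
  rw [mul_comm, Complex.mul_conj, Complex.normSq_eq_norm_sq, torusKnot_eq, norm_sqrt_mul_circ h0]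

theorem normSq_torusKnot_snd (a b : ℤ) {z : ℝ} (h1 : z ≤ 1) (t : ℝ) :
    conj (torusKnot a b z t).2 * (torusKnot a b z t).2 = ((1 - z : ℝ) : ℂ) := by
  rw [mul_comm, Complex.mul_conj, Complex.normSq_eq_norm_sq, torusKnot_eq,
    norm_sqrt_mul_circ (by linarith)]

/-- Multiplication by the conjugate coordinate removes the rotation, so the velocity has components
independent of t. -/
theorem conj_mul_deriv_torusKnot_fst (a b : ℤ) {z : ℝ} (h0 : 0 ≤ z) (t : ℝ) :
    conj (torusKnot a b z t).1 * (deriv (torusKnot a b z) t).1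
      = ((2 * Real.pi * a * z : ℝ) : ℂ) * Complex.I := by
  rw [deriv_torusKnot]
  push_cast
  linear_combination (2 * Real.pi * Complex.I * a) * normSq_torusKnot_fst a b h0 t

theorem conj_mul_deriv_torusKnot_snd (a b : ℤ) {z : ℝ} (h1 : z ≤ 1) (t : ℝ) :
    conj (torusKnot a b z t).2 * (deriv (torusKnot a b z) t).2
      = ((2 * Real.pi * b * (1 - z) : ℝ) : ℂ) * Complex.I := by
  have := normSq_torusKnot_snd a b h1 t
  rw [deriv_torusKnot]
  push_cast at this ⊢
  linear_combination (2 * Real.pi * Complex.I * b) * this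

/-- The direction `(a, b)` is proportional to the characteristic foliation, spanned by `X_p`. -/
theorem HasSlope.exists_smul {p : ℕ} {z : ℝ} {a b : ℤ} (hab : IsCoprime a b)
    (h : HasSlope p z a b) :
    ∃ k : ℝ, k ≠ 0 ∧ (a : ℝ) = k * Real.cos (angle p z) ∧ (b : ℝ) = -(k * Real.sin (angle p z)) := by
  rcases h with ⟨ha, hc, ht⟩ | ⟨ha, hc⟩
  · have ha' : (a : ℝ) ≠ 0 := by exact_mod_cast ha
    refine ⟨a / Real.cos (angle p z), div_ne_zero ha' hc, by field_simp, ?_⟩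
    rw [Real.tan_eq_sin_div_cos] at ht
    field_simp at ht ⊢
    linarith
  · have hb : (b : ℝ) ≠ 0 := by
      intro hb
      have hb' : b = 0 := by exact_mod_cast hb
      subst ha hb'
      exact not_isCoprime_zero_zero hab
    have hs : Real.sin (angle p z) ≠ 0 := by
      intro hs
      have := Real.sin_sq_add_cos_sq (angle p z)
      rw [hs, hc] at this
      norm_num at this
    -- For a vertical slope the cosine vanishes, so k has to be read off from the second equation.
    refine ⟨-(b / Real.sin (angle p z)), neg_ne_zero.2 (div_ne_zero hb hs), by simp [hc, ha], ?_⟩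
    field_simp

theorem isLegendrianKnot_torusKnot {p : ℕ} {a b : ℤ} (hab : IsCoprime a b) {z : ℝ} (h0 : 0 < z)
    (h1 : z < 1) (hsl : Real.sin (angle p z) * a + Real.cos (angle p z) * b = 0) :
    IsLegendrianKnot p (torusKnot a b z) where
  smooth := contDiff_torusKnot a b z
  mem t := cut_mem _ _ _ h0.le h1.le
  periodic := periodic_torusKnot a b z
  injective := by
    intro s hs t ht hst
    obtain ⟨-, h⟩ := (cut_eq_cut_iff _ _ _ _ _ _ h0.le h1.le h0.le h1.le).1 hst
    obtain ⟨⟨k, hk⟩, l, hl⟩ := And.imp (fun h => h.resolve_left h0.ne')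
      (fun h => h.resolve_left h1.ne) h
    obtain ⟨u, v, huv⟩ := hab
    have huv' : (u : ℝ) * a + v * b = 1 := by exact_mod_cast huv
    -- Since a(s − t) = k and b(s − t) = l, the Bézout relation makes s − t an integer; it lies in
    -- (−1, 1), so it is 0.
    have hd : s - t = ((u * k + v * l : ℤ) : ℝ) := by
      push_cast
      linear_combination u * hk + v * hl - (s - t) * huv'
    have h2 : |((u * k + v * l : ℤ) : ℝ)| < 1 := by
      rw [← hd, abs_lt]
      constructor <;> linarith [hs.1, hs.2, ht.1, ht.2]
    have h3 : u * k + v * l = 0 := Int.abs_lt_one_iff.1 (by exact_mod_cast h2)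
    rw [h3] at hd
    simp only [Int.cast_zero] at hd
    linarith
  immersed t h := by
    have e1 := conj_mul_deriv_torusKnot_fst a b h0.le t
    have e2 := conj_mul_deriv_torusKnot_snd a b h1.le t
    have h1' : (1 - z : ℝ) ≠ 0 := by linarith
    rw [h] at e1 e2
    have ha : a = 0 := by simpa [h0.ne', Real.pi_ne_zero] using congrArg Complex.im e1
    have hb : b = 0 := by simpa [h1', Real.pi_ne_zero] using congrArg Complex.im e2
    subst ha hb
    exact not_isCoprime_zero_zero hab
  legendrian t := by
    have e1 := conj_mul_deriv_torusKnot_fst a b h0.le t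
    have e2 := conj_mul_deriv_torusKnot_snd a b h1.le t
    have h1' : (1 - z : ℝ) ≠ 0 := by linarith
    constructor
    · unfold IsTangent
      rw [e1, e2]
      simp
    · refine (cutForm_cut p _ _ z h0 h1 _).trans ?_
      rw [show cut (a * t, b * t, z) = torusKnot a b z t from rfl, e1, e2]
      have h0' := h0.ne'
      have hpi := Real.pi_ne_zero
      rw [Complex.mul_I_im, Complex.mul_I_im, Complex.ofReal_re, Complex.ofReal_re]
      field_simp
      linear_combination hsl

/-- The velocity of a Legendrian torus curve relative to the global frame in torus coordinates. -/
theorem rotatesRelativeTo_frame {p : ℕ} {a b : ℤ} {z k : ℝ} (hk : k ≠ 0)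
    (ha : (a : ℝ) = k * Real.cos (angle p z)) (hb : (b : ℝ) = -(k * Real.sin (angle p z))) :
    RotatesRelativeTo (deriv (torusCurve a b z)) (fun t => frame₁ p (torusCurve a b z t))
      (fun t => frame₂ p (torusCurve a b z t)) (a + (-1) ^ p * b) := by
  have hd : ∀ t, deriv (torusCurve a b z) t = ((a : ℝ), (b : ℝ), (0 : ℝ)) := fun t => by
    have h : ∀ n : ℤ, HasDerivAt (fun t : ℝ => (n : ℝ) * t) n t := fun n => by
      simpa using (hasDerivAt_id t).const_mul (n : ℝ)
    have e : HasDerivAt (torusCurve a b z) ((a : ℝ), (b : ℝ), (0 : ℝ)) t :=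
      (h a).prodMk ((h b).prodMk (hasDerivAt_const t z))
    exact e.deriv
  -- The velocity is k X_p, and X_p = −sin φ · `frame₁` + cos φ · `frame₂` has complex coefficient i
  -- e^{iφ}, where φ = 2π(a + (−1)^p b)t along the curve.
  refine ⟨fun t => k * Complex.I * circ ((a + (-1) ^ p * b : ℤ) * t), fun t => ?_,
    (hasWindingNumber_circ _).const_mul (by simp [hk])⟩
  have hph : phase p (torusCurve a b z t) = 2 * Real.pi * ((a + (-1) ^ p * b : ℤ) * t) := by
    simp only [phase, torusCurve]
    push_cast
    ring
  have hcs := Real.sin_sq_add_cos_sq (2 * Real.pi * ((a + (-1) ^ p * b : ℤ) * t))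
  simp only [hd, frame₁, frame₂, X, dz, hph, mul_assoc (k : ℂ), Complex.re_ofReal_mul,
    Complex.im_ofReal_mul, Complex.I_mul_re, Complex.I_mul_im, circ_re, circ_im]
  simp only [torusCurve]
  generalize Real.sin (2 * Real.pi * ((a + (-1) ^ p * b : ℤ) * t)) = S at *
  generalize Real.cos (2 * Real.pi * ((a + (-1) ^ p * b : ℤ) * t)) = C at *
  ext
  · simp
    linear_combination ha - k * Real.cos (angle p z) * hcs
  · simp
    linear_combination hb + k * Real.sin (angle p z) * hcs
  · simp
    ring

/-! ### Radial projection -/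

theorem IsTangent.normSq_add {w v : ℂ × ℂ} (h : IsTangent w v) (hw : w ∈ S3) (ε : ℝ) :
    ‖(w + ε • v).1‖ ^ 2 + ‖(w + ε • v).2‖ ^ 2 = 1 + ε ^ 2 * (‖v.1‖ ^ 2 + ‖v.2‖ ^ 2) := by
  have hw' : ‖w.1‖ ^ 2 + ‖w.2‖ ^ 2 = 1 := hw
  unfold IsTangent at h
  simp only [← Complex.normSq_eq_norm_sq, Complex.normSq_apply] at hw' ⊢
  simp at h ⊢
  linear_combination hw' + 2 * ε * h

theorem normalize_mem {w : ℂ × ℂ} (hw : 0 < ‖w.1‖ ^ 2 + ‖w.2‖ ^ 2) : normalize w ∈ S3 := by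
  have hs : 0 ≤ (Real.sqrt (‖w.1‖ ^ 2 + ‖w.2‖ ^ 2))⁻¹ := by positivity
  simp only [S3, normalize, Set.mem_ofPred_eq, Prod.smul_fst, Prod.smul_snd, norm_smul,
    Real.norm_of_nonneg hs, mul_pow, inv_pow]
  rw [Real.sq_sqrt hw.le, ← mul_add, inv_mul_cancel₀ hw.ne']

theorem normalize_of_mem {w : ℂ × ℂ} (hw : w ∈ S3) : normalize w = w := by
  have hw' : ‖w.1‖ ^ 2 + ‖w.2‖ ^ 2 = 1 := hw
  simp [normalize, hw']

theorem contDiffAt_normalize {n : WithTop ℕ∞} {w : ℂ × ℂ} (hw : 0 < ‖w.1‖ ^ 2 + ‖w.2‖ ^ 2) :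
    ContDiffAt ℝ n normalize w := by
  have hq : ContDiff ℝ n fun w : ℂ × ℂ => ‖w.1‖ ^ 2 + ‖w.2‖ ^ 2 :=
    (contDiff_fst.norm_sq ℝ).add (contDiff_snd.norm_sq ℝ)
  exact ((hq.contDiffAt.sqrt hw.ne').inv (Real.sqrt_pos.2 hw).ne').smul contDiffAt_id

/-- By Pythagoras the norm of w + εv depends on ε only through ε², so the normalising factor has
zero derivative and radial projection does not change tangent vectors to first order. -/
theorem hasDerivAt_normalize {w v : ℂ × ℂ} (hw : w ∈ S3) (h : IsTangent w v) :
    HasDerivAt (fun ε : ℝ => normalize (w + ε • v)) v 0 := by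
  have h1 : HasDerivAt (fun ε : ℝ => w + ε • v) v 0 := by
    simpa using ((hasDerivAt_id (0 : ℝ)).smul_const v).const_add w
  have h2 : HasDerivAt (fun ε : ℝ => (Real.sqrt (1 + ε ^ 2 * (‖v.1‖ ^ 2 + ‖v.2‖ ^ 2)))⁻¹) 0 0 := by
    have h3 : HasDerivAt (fun ε : ℝ => 1 + ε ^ 2 * (‖v.1‖ ^ 2 + ‖v.2‖ ^ 2)) 0 0 := by
      simpa using (((hasDerivAt_id (0 : ℝ)).pow 2).mul_const (‖v.1‖ ^ 2 + ‖v.2‖ ^ 2)).const_add 1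
    simpa using (h3.sqrt (by simp)).fun_inv (by simp)
  have := h2.smul h1
  simp only [zero_smul, add_zero, ne_eq, OfNat.ofNat_ne_zero, not_false_eq_true, zero_pow, zero_mul,
    Real.sqrt_one, inv_one, one_smul] at this
  refine this.congr_of_eventuallyEq (Filter.Eventually.of_forall fun ε => ?_)
  simp only [normalize, h.normSq_add hw ε, Pi.smul_apply']

/-! ### First order expansion of a function near a closed curve in its zero set -/

theorem periodic_fract {β : Type*} {h : ℝ → β} (ph : Function.Periodic h 1) (t : ℝ) :
    h (Int.fract t) = h t := by
  simpa using ph.sub_int_mul_eq (x := t) ⌊t⌋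

/-- Since Φ vanishes on g, Φ(g + εν) = ε(dΦ(ν) + o(1)), uniformly over a period by compactness, and
Rouché applies. It is used twice: for meridians, with g constant, and for push-offs, with g the
knot. -/
theorem hasWindingNumber_near_zeros {E : Type*} [NormedAddCommGroup E] [NormedSpace ℝ E]
    {Φ : E → ℂ} {g ν : ℝ → E} {n : ℤ} (hg : Continuous g) (hν : Continuous ν)
    (pg : Function.Periodic g 1) (pν : Function.Periodic ν 1)
    (hΦ : ∀ t, ContDiffAt ℝ 1 Φ (g t)) (h0 : ∀ t, Φ (g t) = 0)
    (hw : HasWindingNumber (fun t => fderiv ℝ Φ (g t) (ν t)) n) :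
    ∀ᶠ ε in 𝓝[>] (0 : ℝ), HasWindingNumber (fun t => Φ (g t + ε • ν t)) n := by
  set f : ℝ → ℂ := fun t => fderiv ℝ Φ (g t) (ν t) with hf
  have f0 : ∀ t, f t ≠ 0 := hw.choose_spec.2.1
  have hfc : Continuous f := continuous_iff_continuousAt.2 fun t => by
    have h1 : ContinuousAt (fderiv ℝ Φ) (g t) :=
      ((hΦ t).fderiv_right (m := 0) (by norm_num)).continuousAt
    exact (ContinuousAt.comp (f := g) h1 hg.continuousAt).clm_apply hν.continuousAt
  have pf : Function.Periodic f 1 := fun t => by simp only [hf, pg t, pν t]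
  have near : ∀ t ∈ Set.Icc (0 : ℝ) 1, ∀ᶠ q : ℝ × ℝ in 𝓝 ((0 : ℝ), t),
      (0 < q.1 → ‖Φ (g q.2 + q.1 • ν q.2) - q.1 • f q.2‖ < q.1 * ‖f q.2‖)
        ∧ ContinuousAt Φ (g q.2 + q.1 • ν q.2) := by
    intro t _
    have hm : 0 < ‖f t‖ := norm_pos_iff.2 (f0 t)
    -- Strict differentiability is needed because the base point g q.2 moves together with the
    -- displaced point.
    have hs := (hΦ t).hasStrictFDerivAt (by norm_num)
    have hx : Continuous fun q : ℝ × ℝ => g q.2 + q.1 • ν q.2 := by fun_prop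
    have hy : Continuous fun q : ℝ × ℝ => g q.2 := by fun_prop
    have txy : Filter.Tendsto (fun q : ℝ × ℝ => (g q.2 + q.1 • ν q.2, g q.2)) (𝓝 ((0 : ℝ), t))
        (𝓝 (g t, g t)) := by
      have := (hx.prodMk hy).tendsto ((0 : ℝ), t)
      simpa using this
    have tx : Filter.Tendsto (fun q : ℝ × ℝ => g q.2 + q.1 • ν q.2) (𝓝 ((0 : ℝ), t))
        (𝓝 (g t)) := by
      have := hx.tendsto ((0 : ℝ), t)
      simpa using this
    -- Error budget: the linearisation and the variation of ν and f each cost at most ε‖f t‖/4,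
    -- while ‖f q.2‖ exceeds ‖f t‖/2.
    set c : ℝ := ‖f t‖ / (4 * (‖ν t‖ + 1)) with hc
    have hνp : 0 < ‖ν t‖ + 1 := by positivity
    have hcpos : 0 < c := by positivity
    have E1 := txy.eventually (hs.isLittleO.bound hcpos)
    have E2 : ∀ᶠ q : ℝ × ℝ in 𝓝 ((0 : ℝ), t), ‖ν q.2‖ < ‖ν t‖ + 1 :=
      (isOpen_lt (hν.comp continuous_snd).norm continuous_const).mem_nhds (by simp)
    have E3 : ∀ᶠ q : ℝ × ℝ in 𝓝 ((0 : ℝ), t), ‖fderiv ℝ Φ (g t) (ν q.2) - f q.2‖ < ‖f t‖ / 4 :=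
      (isOpen_lt (((fderiv ℝ Φ (g t)).continuous.comp (hν.comp continuous_snd)).sub
        (hfc.comp continuous_snd)).norm continuous_const).mem_nhds (by simpa [hf] using f0 t)
    have E4 : ∀ᶠ q : ℝ × ℝ in 𝓝 ((0 : ℝ), t), ‖f t‖ / 2 < ‖f q.2‖ :=
      (isOpen_lt continuous_const (hfc.comp continuous_snd).norm).mem_nhds (by simpa using f0 t)
    have E5 := tx.eventually ((hΦ t).eventually (by simp))
    filter_upwards [E1, E2, E3, E4, E5] with q e1 e2 e3 e4 e5
    refine ⟨fun hq => ?_, e5.continuousAt⟩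
    simp only [h0, sub_zero, add_sub_cancel_left, map_smul, norm_smul, Real.norm_of_nonneg hq.le]
      at e1
    have e6 : c * (q.1 * ‖ν q.2‖) ≤ q.1 * (‖f t‖ / 4) := by
      have : c * (‖ν t‖ + 1) = ‖f t‖ / 4 := by
        rw [hc]
        field_simp
      rw [← this]
      nlinarith [mul_pos hcpos hq]
    calc ‖Φ (g q.2 + q.1 • ν q.2) - q.1 • f q.2‖
        = ‖(Φ (g q.2 + q.1 • ν q.2) - q.1 • fderiv ℝ Φ (g t) (ν q.2))
            + q.1 • (fderiv ℝ Φ (g t) (ν q.2) - f q.2)‖ := by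
          congr 1
          rw [smul_sub]
          ring
      _ ≤ c * (q.1 * ‖ν q.2‖) + q.1 * ‖fderiv ℝ Φ (g t) (ν q.2) - f q.2‖ := by
          refine (norm_add_le _ _).trans (add_le_add e1 ?_)
          rw [norm_smul, Real.norm_of_nonneg hq.le]
      _ < q.1 * ‖f q.2‖ := by nlinarith
  have := isCompact_Icc.eventually_forall_of_forall_eventually (P := fun ε t =>
      (0 < ε → ‖Φ (g t + ε • ν t) - ε • f t‖ < ε * ‖f t‖) ∧ ContinuousAt Φ (g t + ε • ν t)) near
  filter_upwards [nhdsWithin_le_nhds this, self_mem_nhdsWithin] with ε hε hpos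
  have hpos' : 0 < ε := hpos
  have hall : ∀ t, ‖Φ (g t + ε • ν t) - ε • f t‖ < ε * ‖f t‖ ∧ ContinuousAt Φ (g t + ε • ν t) := by
    intro t
    have h := hε (Int.fract t) ⟨Int.fract_nonneg t, (Int.fract_lt_one t).le⟩
    rw [periodic_fract pg, periodic_fract pν, periodic_fract pf] at h
    exact ⟨h.1 hpos', h.2⟩
  have hw' : HasWindingNumber (fun t => ε • f t) n := by
    simpa using hw.pos_mul (r := fun _ => ε) fun _ => hpos'
  refine hw'.of_norm_sub_lt (hfc.const_smul ε) ?_ (fun t => by simp only [pf t])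
    (fun t => by simp only [pg t, pν t]) fun t => ?_
  · exact continuous_iff_continuousAt.2 fun t =>
      ContinuousAt.comp (f := fun t => g t + ε • ν t) (hall t).2 (by fun_prop)
  · rw [norm_smul, Real.norm_of_nonneg hpos'.le]
    exact (hall t).1

/-! ### A function which cuts out a torus knot -/

/-- The power `w ^ n`, with `conj w` in place of `w⁻¹` for negative `n`. -/
noncomputable def signedPow (n : ℤ) (w : ℂ) : ℂ :=
  if 0 ≤ n then w ^ n.natAbs else conj w ^ n.natAbs

theorem contDiff_signedPow {m : WithTop ℕ∞} (n : ℤ) : ContDiff ℝ m (signedPow n) := by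
  unfold signedPow
  split_ifs
  · fun_prop
  · exact Complex.conjCLE.contDiff.pow _

/-- Conjugates have the same angle as inverses but stay smooth at 0, so only the modulus sees |n|
instead of n. -/
theorem signedPow_polar (n : ℤ) (r x : ℝ) :
    signedPow n (r * circ x) = (r : ℂ) ^ n.natAbs * circ (n * x) := by
  unfold signedPow
  split_ifs with h
  · rw [mul_pow, circ_pow, Nat.cast_natAbs, abs_of_nonneg h]
  · rw [map_mul, Complex.conj_ofReal, ← circ_neg, mul_pow, circ_pow, Nat.cast_natAbs,
      abs_of_neg (not_le.1 h)]
    push_cast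
    ring_nf

/-- Logarithmic differentiation: conj(u)v/|u|² = d log r + i dθ, and the power multiplies the radial
part by |n| and the angular part by n. -/
theorem hasDerivAt_signedPow (n : ℤ) {u : ℝ → ℂ} {v : ℂ} {t : ℝ} (hu : HasDerivAt u v t)
    (h0 : u t ≠ 0) : HasDerivAt (fun t => signedPow n (u t))
      (signedPow n (u t) * ((|(n : ℝ)| * (conj (u t) * v).re : ℝ)
        + (n * (conj (u t) * v).im : ℝ) * Complex.I) / (‖u t‖ ^ 2 : ℝ)) t := by
  have h1 : conj (u t) ≠ 0 := by simpa using h0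
  have hn : ((‖u t‖ ^ 2 : ℝ) : ℂ) = u t * conj (u t) := by
    rw [Complex.mul_conj, Complex.normSq_eq_norm_sq]
  rw [hn]
  -- The truncated exponent m − 1 is harmless at m = 0, where the factor m vanishes.
  have key : ∀ (m : ℕ) (w v : ℂ), w ≠ 0 → (m : ℂ) * w ^ (m - 1) * v = w ^ m * (m * v) / w := by
    intro m w v hw
    rcases m with _ | m
    · simp
    · simp only [Nat.add_sub_cancel, pow_succ]
      field_simp
  rcases le_or_gt 0 n with h | h
  · have hm : ((n.natAbs : ℕ) : ℂ) = (n : ℂ) := by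
      rw [Nat.cast_natAbs, abs_of_nonneg h]
    have hR : |(n : ℝ)| = n := abs_of_nonneg (by exact_mod_cast h)
    simp only [signedPow, if_pos h, hR]
    refine (hu.fun_pow n.natAbs).congr_deriv ?_
    rw [key _ _ _ h0, hm]
    have h2 := Complex.re_add_im (conj (u t) * v)
    generalize (conj (u t) * v).re = R at *
    generalize (conj (u t) * v).im = J at *
    push_cast
    field_simp
    linear_combination -(n : ℂ) * h2
  · have hm : ((n.natAbs : ℕ) : ℂ) = -(n : ℂ) := by
      rw [Nat.cast_natAbs, abs_of_neg h]
      push_cast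
      ring
    have hR : |(n : ℝ)| = -n := abs_of_neg (by exact_mod_cast h)
    simp only [signedPow, if_neg (not_le.2 h), hR]
    refine (hu.star.fun_pow n.natAbs).congr_deriv ?_
    simp only [← starRingEnd_apply]
    rw [key _ _ _ h1, hm]
    have h2 := congrArg (starRingEnd ℂ) (Complex.re_add_im (conj (u t) * v))
    simp only [map_mul, map_add, Complex.conj_conj, Complex.conj_ofReal, Complex.conj_I] at h2
    generalize (conj (u t) * v).re = R at *
    generalize (conj (u t) * v).im = J at *
    push_cast
    field_simp
    linear_combination (n : ℂ) * h2

/-- The function `w₁^b / |γ₁|^b - w₂^a / |γ₂|^a`, which vanishes along the torus knot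
`γ(t) = (√z e^{2πiat}, √(1-z) e^{2πibt})`. -/
noncomputable def knotFun (a b : ℤ) (z : ℝ) (w : ℂ × ℂ) : ℂ :=
  signedPow b w.1 / (Real.sqrt z : ℂ) ^ b.natAbs
    - signedPow a w.2 / (Real.sqrt (1 - z) : ℂ) ^ a.natAbs

theorem contDiff_knotFun {m : WithTop ℕ∞} (a b : ℤ) (z : ℝ) : ContDiff ℝ m (knotFun a b z) :=
  (((contDiff_signedPow b).comp contDiff_fst).div_const _).sub
    (((contDiff_signedPow a).comp contDiff_snd).div_const _)

theorem signedPow_torusKnot_fst (a b : ℤ) {z : ℝ} (h0 : 0 < z) (t : ℝ) :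
    signedPow b (torusKnot a b z t).1 / (Real.sqrt z : ℂ) ^ b.natAbs
      = circ ((a * b : ℤ) * t) := by
  have : (Real.sqrt z : ℂ) ≠ 0 := by exact_mod_cast (Real.sqrt_pos.2 h0).ne'
  rw [torusKnot_eq, signedPow_polar, mul_div_cancel_left₀ _ (pow_ne_zero _ this)]
  push_cast
  ring_nf

theorem signedPow_torusKnot_snd (a b : ℤ) {z : ℝ} (h1 : z < 1) (t : ℝ) :
    signedPow a (torusKnot a b z t).2 / (Real.sqrt (1 - z) : ℂ) ^ a.natAbs
      = circ ((a * b : ℤ) * t) := by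
  have : (Real.sqrt (1 - z) : ℂ) ≠ 0 := by
    exact_mod_cast (Real.sqrt_pos.2 (by linarith : 0 < 1 - z)).ne'
  rw [torusKnot_eq, signedPow_polar, mul_div_cancel_left₀ _ (pow_ne_zero _ this)]
  push_cast
  ring_nf

theorem knotFun_torusKnot (a b : ℤ) {z : ℝ} (h0 : 0 < z) (h1 : z < 1) (t : ℝ) :
    knotFun a b z (torusKnot a b z t) = 0 := by
  rw [knotFun, signedPow_torusKnot_fst a b h0, signedPow_torusKnot_snd a b h1, sub_self]

theorem pow_lt_of_lt_of_gt {m n : ℕ} (h : m ≠ 0 ∨ n ≠ 0) {x y : ℝ} (hx : 1 < x) (hy0 : 0 ≤ y)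
    (hy : y < 1) : y ^ n < x ^ m := by
  rcases h with h | h
  · exact (pow_le_one₀ hy0 hy.le).trans_lt (one_lt_pow₀ hx h)
  · exact (pow_lt_one₀ hy0 hy h).trans_le (one_le_pow₀ hx.le)

/-- The zero set of `knotFun` on the sphere is the torus knot. -/
theorem mem_range_of_knotFun_eq_zero {a b : ℤ} (hab : IsCoprime a b) {z : ℝ} (h0 : 0 < z)
    (h1 : z < 1) {w : ℂ × ℂ} (hw : w ∈ S3) (h : knotFun a b z w = 0) :
    w ∈ Set.range (torusKnot a b z) := by
  obtain ⟨x, y, z', h0', h1', rfl⟩ := cut_surjective w hw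
  have hr : 0 < Real.sqrt z := Real.sqrt_pos.2 h0
  have hs : 0 < Real.sqrt (1 - z) := Real.sqrt_pos.2 (by linarith)
  have hrc : (Real.sqrt z : ℂ) ≠ 0 := by exact_mod_cast hr.ne'
  have hsc : (Real.sqrt (1 - z) : ℂ) ≠ 0 := by exact_mod_cast hs.ne'
  have hne : b.natAbs ≠ 0 ∨ a.natAbs ≠ 0 := by
    by_contra hcon
    push Not at hcon
    rw [Int.natAbs_eq_zero, Int.natAbs_eq_zero] at hcon
    rw [hcon.1, hcon.2] at hab
    exact not_isCoprime_zero_zero hab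
  rw [knotFun, sub_eq_zero, cut_eq, signedPow_polar, signedPow_polar] at h
  have hn := congrArg norm h
  simp only [norm_div, norm_mul, norm_pow, norm_circ, mul_one, Complex.norm_real, Real.norm_eq_abs,
    abs_of_nonneg (Real.sqrt_nonneg _), ← div_pow] at hn
  -- In the equation of moduli one side increases with z' and the other decreases, at least one of
  -- them strictly; they agree at z.
  have hz : z' = z := by
    rcases lt_trichotomy z' z with hlt | heq | hgt
    · have k1 : Real.sqrt z' / Real.sqrt z < 1 := by
        rw [div_lt_one hr]
        exact Real.sqrt_lt_sqrt h0' hlt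
      have k2 : 1 < Real.sqrt (1 - z') / Real.sqrt (1 - z) := by
        rw [one_lt_div hs]
        exact Real.sqrt_lt_sqrt (by linarith) (by linarith)
      exact absurd hn (pow_lt_of_lt_of_gt hne.symm k2 (by positivity) k1).ne
    · exact heq
    · have k1 : 1 < Real.sqrt z' / Real.sqrt z := by
        rw [one_lt_div hr]
        exact Real.sqrt_lt_sqrt h0.le hgt
      have k2 : Real.sqrt (1 - z') / Real.sqrt (1 - z) < 1 := by
        rw [div_lt_one hs]
        exact Real.sqrt_lt_sqrt (by linarith) (by linarith)
      exact absurd hn (pow_lt_of_lt_of_gt hne k1 (by positivity) k2).ne'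
  subst hz
  rw [mul_div_cancel_left₀ _ (pow_ne_zero _ hrc), mul_div_cancel_left₀ _ (pow_ne_zero _ hsc)] at h
  obtain ⟨-, h | ⟨k, hk⟩⟩ := (polar_eq_iff 1 1 (b * x) (a * y) zero_le_one zero_le_one).1
    (by simpa [circ] using h)
  · norm_num at h
  obtain ⟨u, v, huv⟩ := hab
  have huv' : (u : ℝ) * a + v * b = 1 := by exact_mod_cast huv
  -- Equal angles mean bx = ay + k. With ua + vb = 1, the parameter t = ux + vy gives at = x − vk
  -- and bt = y + uk.
  refine ⟨u * x + v * y, (cut_eq_cut_iff _ _ _ _ _ _ h0.le h1.le h0.le h1.le).2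
    ⟨rfl, Or.inr ⟨-(v * k), ?_⟩, Or.inr ⟨u * k, ?_⟩⟩⟩
  · push_cast
    linear_combination x * huv' - v * hk
  · push_cast
    linear_combination y * huv' + u * hk

/-- The derivative of `knotFun` on the tangent space of the sphere, along the torus knot. -/
theorem fderiv_knotFun_normalize (a b : ℤ) {z : ℝ} (h0 : 0 < z) (h1 : z < 1) (t : ℝ) {v : ℂ × ℂ}
    (hv : IsTangent (torusKnot a b z t) v) :
    fderiv ℝ (fun w => knotFun a b z (normalize w)) (torusKnot a b z t) v =
      circ ((a * b : ℤ) * t) *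
        (((|(b : ℝ)| / z + |(a : ℝ)| / (1 - z)) * (conj (torusKnot a b z t).1 * v.1).re : ℝ)
          + (b / z * (conj (torusKnot a b z t).1 * v.1).im
            - a / (1 - z) * (conj (torusKnot a b z t).2 * v.2).im : ℝ) * Complex.I) := by
  have h1' : 0 < 1 - z := by linarith
  have hmem : torusKnot a b z t ∈ S3 := cut_mem _ _ _ h0.le h1.le
  have hmem' : ‖(torusKnot a b z t).1‖ ^ 2 + ‖(torusKnot a b z t).2‖ ^ 2 = 1 := hmem
  have hn1 : ‖(torusKnot a b z t).1‖ ^ 2 = z := norm_sqrt_mul_circ h0.le _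
  have hn2 : ‖(torusKnot a b z t).2‖ ^ 2 = 1 - z := norm_sqrt_mul_circ h1'.le _
  have e1 := signedPow_torusKnot_fst a b h0 t
  have e2 := signedPow_torusKnot_snd a b h1 t
  have hd : DifferentiableAt ℝ (fun w => knotFun a b z (normalize w)) (torusKnot a b z t) :=
    (((contDiff_knotFun a b z).contDiffAt (n := 1)).comp _
      (contDiffAt_normalize (by rw [hmem']; norm_num))).differentiableAt (by norm_num)
  rw [← hd.lineDeriv_eq_fderiv]
  refine HasLineDerivAt.lineDeriv (v := v) ?_
  have hc := hasDerivAt_normalize hmem hv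
  have hc0 : normalize (torusKnot a b z t + (0 : ℝ) • v) = torusKnot a b z t := by
    rw [zero_smul, add_zero, normalize_of_mem hmem]
  have ne1 : (torusKnot a b z t).1 ≠ 0 := fun h => by
    rw [h] at hn1
    simp at hn1
    linarith
  have ne2 : (torusKnot a b z t).2 ≠ 0 := fun h => by
    rw [h] at hn2
    simp at hn2
    linarith
  have hd1 := (hasDerivAt_signedPow b hc.fst (by rw [hc0]; exact ne1)).div_const
    ((Real.sqrt z : ℂ) ^ b.natAbs)
  have hd2 := (hasDerivAt_signedPow a hc.snd (by rw [hc0]; exact ne2)).div_const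
    ((Real.sqrt (1 - z) : ℂ) ^ a.natAbs)
  refine HasDerivAt.congr_deriv (hd1.sub hd2) ?_
  rw [hc0, hn1, hn2]
  -- On the sphere the radii of the two coordinates vary oppositely, so the two radial terms add up
  -- with the positive weight |b|/z + |a|/(1 − z).
  have e3 : (conj (torusKnot a b z t).2 * v.2).re = -(conj (torusKnot a b z t).1 * v.1).re := by
    unfold IsTangent at hv
    linarith
  rw [e3]
  generalize (conj (torusKnot a b z t).1 * v.1).re = ρ at *
  generalize (conj (torusKnot a b z t).1 * v.1).im = θ at *
  generalize (conj (torusKnot a b z t).2 * v.2).im = η at *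
  generalize circ ((a * b : ℤ) * t) = G at *
  push_cast
  have hzc : (z : ℂ) ≠ 0 := by exact_mod_cast h0.ne'
  have hzc' : (1 - z : ℂ) ≠ 0 := by exact_mod_cast h1'.ne'
  linear_combination (((|(b : ℝ)| : ℝ) * ρ + b * θ * Complex.I) / z) * e1
    - ((-(|(a : ℝ)| : ℝ) * ρ + a * η * Complex.I) / (1 - z)) * e2

/-! ### The Thurston–Bennequin invariant -/

/-- The coordinates `(conj w₁ v₁, conj w₂ v₂)` of a vector `v` at the point `w`. -/
noncomputable def polarVec (w v : ℂ × ℂ) : ℂ × ℂ := (conj w.1 * v.1, conj w.2 * v.2)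

/-- Passing to polar components is a block-diagonal map of positive determinant off the core
circles, so orientation can be checked where the velocity of the knot is constant. -/
theorem det4_polarVec (w e₀ e₁ e₂ : ℂ × ℂ) :
    det4 (polarVec w w) (polarVec w e₀) (polarVec w e₁) (polarVec w e₂)
      = Complex.normSq w.1 * Complex.normSq w.2 * det4 w e₀ e₁ e₂ := by
  obtain ⟨⟨a₁, a₂⟩, a₃, a₄⟩ := w
  have hN : Matrix.det !![a₁, -a₂, 0, 0; a₂, a₁, 0, 0; 0, 0, a₃, -a₄; 0, 0, a₄, a₃]
      = (a₁ * a₁ + a₂ * a₂) * (a₃ * a₃ + a₄ * a₄) := by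
    simp [Matrix.det_succ_row_zero, Fin.sum_univ_succ, Fin.succAbove]
    ring
  rw [Complex.normSq_mk, Complex.normSq_mk, ← hN, mul_comm, det4, det4, ← Matrix.det_mul]
  congr 1
  ext i j
  fin_cases i <;> fin_cases j <;>
    simp [polarVec, Matrix.mul_apply, Fin.sum_univ_succ] <;> ring

theorem pushOff_pos {w v : ℂ × ℂ} (h : IsTangent w v) (hw : w ∈ S3) (ε : ℝ) :
    0 < ‖(w + ε • v).1‖ ^ 2 + ‖(w + ε • v).2‖ ^ 2 := by
  rw [h.normSq_add hw]
  positivity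

theorem contDiffAt_knotFun_normalize (a b : ℤ) (z : ℝ) {w : ℂ × ℂ} (hw : w ∈ S3) :
    ContDiffAt ℝ 1 (fun w => knotFun a b z (normalize w)) w := by
  have hw' : ‖w.1‖ ^ 2 + ‖w.2‖ ^ 2 = 1 := hw
  exact (contDiff_knotFun a b z).contDiffAt.comp _
    (contDiffAt_normalize (by rw [hw']; norm_num))

theorem isMeridianGenerator_knotFun {a b : ℤ} (hab : IsCoprime a b) {z : ℝ} (h0 : 0 < z)
    (h1 : z < 1) : IsMeridianGenerator (torusKnot a b z) (knotFun a b z) where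
  continuousOn := (contDiff_knotFun (m := 0) a b z).continuous.continuousOn
  ne_zero w hw h := hw.2 (mem_range_of_knotFun_eq_zero hab h0 h1 hw.1 h)
  meridian t e₁ e₂ he₁ he₂ hdet := by
    have h1' : 0 < 1 - z := by linarith
    have hmem : torusKnot a b z t ∈ S3 := cut_mem _ _ _ h0.le h1.le
    have hper : Function.Periodic (fun s : ℝ => Real.cos (2 * Real.pi * s) • e₁
        + Real.sin (2 * Real.pi * s) • e₂) 1 := fun s => by
      simp only [mul_add, mul_one, Real.cos_add_two_pi, Real.sin_add_two_pi]
    have key := hasWindingNumber_near_zeros (Φ := fun w => knotFun a b z (normalize w))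
      (g := fun _ => torusKnot a b z t)
      (ν := fun s => Real.cos (2 * Real.pi * s) • e₁ + Real.sin (2 * Real.pi * s) • e₂) (n := 1)
      continuous_const (by fun_prop) (fun _ => rfl) hper
      (fun _ => contDiffAt_knotFun_normalize a b z hmem)
      (fun _ => by rw [normalize_of_mem hmem, knotFun_torusKnot a b h0 h1])
    refine key ?_
    simp only [map_add, map_smul, Complex.real_smul]
    -- To first order a small meridian is mapped to an ellipse; it remains to see that dF preserves
    -- the orientation of the normal plane.
    refine hasWindingNumber_ellipse ?_
    rw [fderiv_knotFun_normalize a b h0 h1 t he₁, fderiv_knotFun_normalize a b h0 h1 t he₂]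
    have hG := conj_circ_mul ((a * b : ℤ) * t)
    have hK : 0 < |(b : ℝ)| / z + |(a : ℝ)| / (1 - z) := by
      have k1 : 0 ≤ |(b : ℝ)| / z := by positivity
      have k2 : 0 ≤ |(a : ℝ)| / (1 - z) := by positivity
      refine (add_nonneg k1 k2).lt_of_ne fun hk => ?_
      have hb : |(b : ℝ)| / z = 0 := by linarith
      have ha : |(a : ℝ)| / (1 - z) = 0 := by linarith
      rw [div_eq_zero_iff, or_iff_left h0.ne', abs_eq_zero, Int.cast_eq_zero] at hb
      rw [div_eq_zero_iff, or_iff_left h1'.ne', abs_eq_zero, Int.cast_eq_zero] at ha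
      rw [ha, hb] at hab
      exact not_isCoprime_zero_zero hab
    have hn1 : 0 < Complex.normSq (torusKnot a b z t).1 := by
      rw [Complex.normSq_eq_norm_sq, torusKnot_eq, norm_sqrt_mul_circ h0.le]
      exact h0
    have hn2 : 0 < Complex.normSq (torusKnot a b z t).2 := by
      rw [Complex.normSq_eq_norm_sq, torusKnot_eq, norm_sqrt_mul_circ h1'.le]
      exact h1'
    have hdet' := mul_pos (mul_pos hn1 hn2) hdet
    rw [← det4_polarVec] at hdet'
    unfold polarVec at hdet'
    rw [conj_mul_deriv_torusKnot_fst a b h0.le, conj_mul_deriv_torusKnot_snd a b h1.le,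
      normSq_torusKnot_fst a b h0.le, normSq_torusKnot_snd a b h1.le] at hdet'
    unfold IsTangent at he₁ he₂
    generalize hG' : circ ((a * b : ℤ) * t) = G at *
    generalize conj (torusKnot a b z t).1 * e₁.1 = u₁ at *
    generalize conj (torusKnot a b z t).2 * e₁.2 = u₂ at *
    generalize conj (torusKnot a b z t).1 * e₂.1 = v₁ at *
    generalize conj (torusKnot a b z t).2 * e₂.2 = v₂ at *
    have hu : u₂.re = -u₁.re := by linarith
    have hv : v₂.re = -v₁.re := by linarith
    generalize |(b : ℝ)| / z + |(a : ℝ)| / (1 - z) = K at *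
    -- The determinant in polar components is 2πz(1 − z) times this expression: its first two rows
    -- are the radial vector and the velocity.
    have hD : 0 < u₁.re * (b / z * v₁.im - a / (1 - z) * v₂.im)
        - v₁.re * (b / z * u₁.im - a / (1 - z) * u₂.im) := by
      have hpos : 0 < 2 * Real.pi * (z * (1 - z)) := by positivity
      refine (mul_pos_iff_of_pos_left hpos).1 ?_
      refine hdet'.trans_eq ?_
      simp [det4, Matrix.det_succ_row_zero, Fin.sum_univ_succ, Fin.succAbove, hu, hv]
      field_simp
      ring
    generalize b / z * u₁.im - a / (1 - z) * u₂.im = σ at *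
    generalize b / z * v₁.im - a / (1 - z) * v₂.im = τ at *
    have hpos := mul_pos hK hD
    refine hpos.trans_eq ?_
    rw [map_mul, mul_mul_mul_comm, hG, one_mul]
    simp
    ring

theorem hasThurstonBennequin_torusKnot {p : ℕ} {a b : ℤ} (hab : IsCoprime a b) {z k : ℝ}
    (h0 : 0 < z) (h1 : z < 1) (hk : k ≠ 0) (ha : (a : ℝ) = k * Real.cos (angle p z))
    (hb : (b : ℝ) = -(k * Real.sin (angle p z))) :
    HasThurstonBennequin p (torusKnot a b z) (a * b) := by
  have h1' : 0 < 1 - z := by linarith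
  have hmem : ∀ t, torusKnot a b z t ∈ S3 := fun t => cut_mem _ _ _ h0.le h1.le
  have hcut : ∀ t v, cutForm p (torusKnot a b z t) v = _ := fun t v => cutForm_cut p _ _ z h0 h1 v
  constructor
  · refine ⟨fun t => ((Real.sin (angle p z) : ℂ) * Complex.I * (torusKnot a b z t).1,
      (Real.cos (angle p z) : ℂ) * Complex.I * (torusKnot a b z t).2), ?_, ?_, ?_, ?_⟩
    · have := continuous_torusKnot a b z
      fun_prop
    · intro t
      simp only [periodic_torusKnot a b z t]
    · intro t
      unfold IsTangent
      simp only [mul_left_comm (conj (torusKnot a b z t).1), mul_left_comm (conj (torusKnot a b z t).2),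
        normSq_torusKnot_fst a b h0.le, normSq_torusKnot_snd a b h1.le]
      simp
    · intro t
      rw [hcut]
      change (2 * Real.pi)⁻¹ * (Real.sin (angle p z) / z * (conj (torusKnot a b z t).1 * _).im
        + Real.cos (angle p z) / (1 - z) * (conj (torusKnot a b z t).2 * _).im) ≠ 0
      simp only [mul_left_comm (conj (torusKnot a b z t).1), mul_left_comm (conj (torusKnot a b z t).2),
        normSq_torusKnot_fst a b h0.le, normSq_torusKnot_snd a b h1.le]
      have e : Real.sin (angle p z) / z * ((Real.sin (angle p z) : ℂ) * Complex.I * (z : ℂ)).im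
          + Real.cos (angle p z) / (1 - z)
            * ((Real.cos (angle p z) : ℂ) * Complex.I * ((1 - z : ℝ) : ℂ)).im = 1 := by
        have hcs := Real.sin_sq_add_cos_sq (angle p z)
        generalize Real.sin (angle p z) = S at *
        generalize Real.cos (angle p z) = C at *
        have := h0.ne'
        have := h1'.ne'
        rw [Complex.im_mul_ofReal, Complex.im_mul_ofReal, Complex.mul_I_im, Complex.mul_I_im,
          Complex.ofReal_re, Complex.ofReal_re]
        refine Eq.trans ?_ hcs
        congr 1 <;> field_simp
      rw [e]
      have := Real.pi_ne_zero
      positivity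
  · intro ν hν
    have hγ := continuous_torusKnot a b z
    have hνc := hν.continuous
    have key := hasWindingNumber_near_zeros (Φ := fun w => knotFun a b z (normalize w))
      (g := torusKnot a b z) (ν := ν) (n := a * b) hγ hνc (periodic_torusKnot a b z) hν.periodic
      (fun t => contDiffAt_knotFun_normalize a b z (hmem t))
      (fun t => by rw [normalize_of_mem (hmem t), knotFun_torusKnot a b h0 h1])
    have hw : HasWindingNumber (fun t => fderiv ℝ (fun w => knotFun a b z (normalize w))
        (torusKnot a b z t) (ν t)) (a * b) := by
      simp only [fun t => fderiv_knotFun_normalize a b h0 h1 t (hν.tangent t)]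
      set ρ : ℝ → ℝ := fun t => (|(b : ℝ)| / z + |(a : ℝ)| / (1 - z))
        * (conj (torusKnot a b z t).1 * (ν t).1).re with hρ
      set τ : ℝ → ℝ := fun t => b / z * (conj (torusKnot a b z t).1 * (ν t).1).im
        - a / (1 - z) * (conj (torusKnot a b z t).2 * (ν t).2).im with hτ
      have c1 : Continuous fun t => conj (torusKnot a b z t).1 * (ν t).1 :=
        (Complex.continuous_conj.comp hγ.fst).mul hνc.fst
      have c2 : Continuous fun t => conj (torusKnot a b z t).2 * (ν t).2 :=
        (Complex.continuous_conj.comp hγ.snd).mul hνc.snd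
      have hρc : Continuous ρ := continuous_const.mul (Complex.continuous_re.comp c1)
      have hτc : Continuous τ := (continuous_const.mul (Complex.continuous_im.comp c1)).sub
        (continuous_const.mul (Complex.continuous_im.comp c2))
      -- This is where the Legendrian direction enters: b = −k sin and a = k cos make τ a nonzero
      -- multiple of the contact form on ν.
      have hτ0 : ∀ t, τ t ≠ 0 := fun t h => by
        refine hν.transverse t ?_
        rw [hcut]
        have : τ t = -k * (Real.sin (angle p z) / z * (conj (torusKnot a b z t).1 * (ν t).1).im
            + Real.cos (angle p z) / (1 - z) * (conj (torusKnot a b z t).2 * (ν t).2).im) := by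
          simp only [hτ, ha, hb]
          ring
        rw [this] at h
        exact mul_eq_zero_of_right _ ((mul_eq_zero.1 h).resolve_left (neg_ne_zero.2 hk))
      have hu : HasWindingNumber (fun t => (ρ t : ℂ) + τ t * Complex.I) 0 := by
        have hper : ∀ t, ρ (t + 1) = ρ t ∧ τ (t + 1) = τ t := fun t => by
          simp only [hρ, hτ, periodic_torusKnot a b z t, hν.periodic t, and_self]
        -- The constant −iτ(0) turns the half-plane containing the loop into the right half-plane:
        -- the real part becomes τ(0)τ(t), positive by the intermediate value theorem.
        have hsl : HasWindingNumber (fun t => -Complex.I * τ 0 * ((ρ t : ℂ) + τ t * Complex.I)) 0 := by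
          refine hasWindingNumber_of_mem_slitPlane (by fun_prop)
            (fun t => by simp only [(hper t).1, (hper t).2]) fun t => Or.inl ?_
          have hsign : 0 < τ 0 * τ t := by
            by_contra hcon
            have hle : τ 0 * τ t ≤ 0 := not_lt.1 hcon
            have : (0 : ℝ) ∈ Set.range fun s => τ 0 * τ s :=
              mem_range_of_exists_le_of_exists_ge (by fun_prop) ⟨t, hle⟩
                ⟨0, mul_self_nonneg _⟩
            obtain ⟨s, hs⟩ := this
            exact mul_ne_zero (hτ0 0) (hτ0 s) hs
          refine hsign.trans_eq ?_
          simp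
        have hc : -Complex.I * τ 0 ≠ 0 := by simp [hτ0 0]
        convert hsl.const_mul (inv_ne_zero hc) using 2 with t
        rw [inv_mul_cancel_left₀ hc]
      have := (hasWindingNumber_circ (a * b)).mul hu
      rwa [add_zero] at this
    filter_upwards [key hw] with ε hε
    have hc : Continuous (pushOff (torusKnot a b z) ν ε) := continuous_iff_continuousAt.2 fun t =>
      ContinuousAt.comp (f := fun t => torusKnot a b z t + ε • ν t)
        (contDiffAt_normalize (n := 0) (pushOff_pos (hν.tangent t) (hmem t) ε)).continuousAt
        (by fun_prop)
    refine ⟨hc, fun t => ?_, fun t => ⟨normalize_mem (pushOff_pos (hν.tangent t) (hmem t) ε), ?_⟩,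
      knotFun a b z, isMeridianGenerator_knotFun hab h0 h1, hε⟩
    · simp only [pushOff, periodic_torusKnot a b z t, hν.periodic t]
    · rintro ⟨s, hs⟩
      -- F has no zero on the push-off, because a winding number is defined there, but vanishes on
      -- the knot.
      refine hε.choose_spec.2.1 t ?_
      have := knotFun_torusKnot a b h0 h1 s
      rw [hs] at this
      exact this

/-! ### Coefficients with respect to a continuous frame -/

/-- Cramer's rule for the Gram matrix. Its determinant D is nonzero, since |Z₂|²Z₁ − ⟨Z₁, Z₂⟩Z₂ has
squared norm |Z₂|²D. -/
theorem continuous_coeff {T E : Type*} [TopologicalSpace T] [NormedAddCommGroup E]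
    [InnerProductSpace ℝ E] {Z₁ Z₂ Y : T → E} {x y : T → ℝ} (h₁ : Continuous Z₁)
    (h₂ : Continuous Z₂) (hY : Continuous Y) (hli : ∀ t, LinearIndependent ℝ ![Z₁ t, Z₂ t])
    (hxy : ∀ t, Y t = x t • Z₁ t + y t • Z₂ t) : Continuous x ∧ Continuous y := by
  set D : T → ℝ := fun t =>
    inner ℝ (Z₁ t) (Z₁ t) * inner ℝ (Z₂ t) (Z₂ t) - inner ℝ (Z₁ t) (Z₂ t) ^ 2 with hD
  have hDc : Continuous D := by fun_prop
  have hD0 : ∀ t, D t ≠ 0 := fun t h => by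
    have key : inner ℝ (inner ℝ (Z₂ t) (Z₂ t) • Z₁ t + (-inner ℝ (Z₁ t) (Z₂ t)) • Z₂ t)
        (inner ℝ (Z₂ t) (Z₂ t) • Z₁ t + (-inner ℝ (Z₁ t) (Z₂ t)) • Z₂ t)
        = inner ℝ (Z₂ t) (Z₂ t) * D t := by
      simp only [inner_add_left, inner_add_right, real_inner_smul_left, real_inner_smul_right,
        real_inner_comm (Z₁ t) (Z₂ t), hD]
      ring
    rw [h, mul_zero, inner_self_eq_zero] at key
    have h2 := (LinearIndependent.pair_iff.1 (hli t) _ _ key).1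
    rw [inner_self_eq_zero] at h2
    exact (hli t).ne_zero 1 h2
  have ex : ∀ t, x t = (inner ℝ (Z₁ t) (Y t) * inner ℝ (Z₂ t) (Z₂ t)
      - inner ℝ (Z₂ t) (Y t) * inner ℝ (Z₁ t) (Z₂ t)) / D t := fun t => by
    rw [eq_div_iff (hD0 t), hxy t]
    simp only [inner_add_right, real_inner_smul_right, real_inner_comm (Z₁ t) (Z₂ t), hD]
    ring
  have ey : ∀ t, y t = (inner ℝ (Z₁ t) (Z₁ t) * inner ℝ (Z₂ t) (Y t)
      - inner ℝ (Z₁ t) (Z₂ t) * inner ℝ (Z₁ t) (Y t)) / D t := fun t => by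
    rw [eq_div_iff (hD0 t), hxy t]
    simp only [inner_add_right, real_inner_smul_right, real_inner_comm (Z₁ t) (Z₂ t), hD]
    ring
  rw [funext ex, funext ey]
  exact ⟨Continuous.div (by fun_prop) hDc hD0, Continuous.div (by fun_prop) hDc hD0⟩

/-- The product ℂ × ℂ carries the sup norm, so the vectors are moved to the Euclidean product first.
-/
theorem continuous_coeff_prod {T : Type*} [TopologicalSpace T] {Z₁ Z₂ Y : T → ℂ × ℂ}
    {x y : T → ℝ} (h₁ : Continuous Z₁) (h₂ : Continuous Z₂) (hY : Continuous Y)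
    (hli : ∀ t, LinearIndependent ℝ ![Z₁ t, Z₂ t])
    (hxy : ∀ t, Y t = x t • Z₁ t + y t • Z₂ t) : Continuous x ∧ Continuous y := by
  let e := (WithLp.prodContinuousLinearEquiv 2 ℝ ℂ ℂ).symm
  refine continuous_coeff (Z₁ := fun t => e (Z₁ t)) (Z₂ := fun t => e (Z₂ t))
    (Y := fun t => e (Y t)) (e.continuous.comp h₁) (e.continuous.comp h₂) (e.continuous.comp hY)
    (fun t => ?_) fun t => by rw [hxy t, map_add, map_smul, map_smul]
  rw [LinearIndependent.pair_iff]
  intro r s h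
  rw [← map_smul, ← map_smul, ← map_add, map_eq_zero_iff e e.injective] at h
  exact LinearIndependent.pair_iff.1 (hli t) r s h

/-! ### A global frame -/

/-- The vector `u ↦ v` with `conj u * v = Re M + iβ Im M` for `M = conj u * m`. -/
noncomputable def shear (β : ℝ) (m u : ℂ) : ℂ :=
  ((1 + β) / 2 : ℝ) * m + ((1 - β) / 2 : ℝ) * conj m * (u / conj u)

theorem conj_mul_shear (β : ℝ) (m u : ℂ) :
    conj u * shear β m u = ((conj u * m).re : ℂ) + (β * (conj u * m).im : ℝ) * Complex.I := by
  have h : conj u * shear β m u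
      = ((1 + β) / 2 : ℝ) * (conj u * m) + ((1 - β) / 2 : ℝ) * conj (conj u * m) := by
    by_cases hu : u = 0
    · simp [hu]
    · have hu' : conj u ≠ 0 := by simpa using hu
      unfold shear
      rw [map_mul, Complex.conj_conj]
      field_simp
  rw [h]
  generalize conj u * m = M
  apply Complex.ext <;> simp <;> ring

theorem shear_one (m u : ℂ) : shear 1 m u = m := by simp [shear]

theorem shear_zero_mid (β : ℝ) (u : ℂ) : shear β 0 u = 0 := by simp [shear]

theorem shear_add (β : ℝ) (m m' u : ℂ) : shear β (m + m') u = shear β m u + shear β m' u := by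
  simp only [shear, map_add]
  ring

theorem shear_real_mul (β r : ℝ) (m u : ℂ) : shear β (r * m) u = r * shear β m u := by
  simp only [shear, map_mul, Complex.conj_ofReal]
  ring

/-- The quotient u / conj u is bounded but has no limit at 0; its coefficient (1 − β)/2 tends to 0
there. -/
theorem continuous_shear {T : Type*} [TopologicalSpace T] {β : T → ℝ} {m u : T → ℂ}
    (hβ : Continuous β) (hm : Continuous m) (hu : Continuous u) (h : ∀ t, u t = 0 → β t = 1) :
    Continuous fun t => shear (β t) (m t) (u t) := by
  unfold shear
  refine Continuous.add (by fun_prop) (continuous_iff_continuousAt.2 fun t => ?_)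
  have hc : Continuous fun t => (((1 - β t) / 2 : ℝ) : ℂ) * conj (m t) :=
    Continuous.mul (by fun_prop) (Complex.continuous_conj.comp hm)
  by_cases h0 : u t = 0
  · have hz : (((1 - β t) / 2 : ℝ) : ℂ) * conj (m t) = 0 := by simp [h t h0]
    unfold ContinuousAt
    beta_reduce
    rw [hz, zero_mul]
    refine squeeze_zero_norm (a := fun t => ‖(((1 - β t) / 2 : ℝ) : ℂ) * conj (m t)‖) (fun s => ?_) ?_
    · rw [norm_mul, norm_div, RCLike.norm_conj]
      exact mul_le_of_le_one_right (norm_nonneg _) (div_self_le_one _)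
    · have := hc.norm.tendsto t
      rwa [hz, norm_zero] at this
  · exact hc.continuousAt.mul (hu.continuousAt.div
      (Complex.continuous_conj.comp hu).continuousAt (by simpa using h0))

/-- The function `(-1)^p c sinc(c|u|²)`, `c = (2p+1)π/2`. -/
noncomputable def shearFactor (p : ℕ) (u : ℂ) : ℝ :=
  (-1) ^ p * (angle p 1 * Real.sinc (angle p (‖u‖ ^ 2)))

theorem continuous_shearFactor (p : ℕ) : Continuous (shearFactor p) := by
  unfold shearFactor angle
  have := Real.continuous_sinc
  fun_prop

theorem neg_one_pow_mul_self (p : ℕ) : ((-1 : ℝ) ^ p) * (-1) ^ p = 1 := by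
  rw [← mul_pow]
  simp

theorem shearFactor_of_norm_sq {p : ℕ} {u : ℂ} {r : ℝ} (hr : r ≠ 0) (hu : ‖u‖ ^ 2 = r) :
    shearFactor p u = (-1) ^ p * Real.sin (angle p r) / r := by
  have a0 := angle_ne_zero p one_ne_zero
  have a1 : angle p r = angle p 1 * r := by
    unfold angle
    ring
  rw [shearFactor, hu, Real.sinc_of_ne_zero (angle_ne_zero p hr)]
  generalize Real.sin (angle p r) = S
  rw [a1]
  field_simp

/-- The sign in `shearFactor` is chosen to cancel sin((2p+1)π/2) = (−1)^p. The shears thus become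
trivial on the core circles, which lets the frame extend over them. -/
theorem shearFactor_of_norm_sq_one {p : ℕ} {u : ℂ} (hu : ‖u‖ ^ 2 = 1) : shearFactor p u = 1 := by
  have h := sin_angle_one_sub p 0
  have h0 : angle p 0 = 0 := by simp [angle]
  rw [sub_zero, h0, Real.cos_zero, mul_one] at h
  rw [shearFactor_of_norm_sq one_ne_zero hu, h, neg_one_pow_mul_self, div_one]

/-- Complex conjugation for odd `p`, the identity for even `p`. -/
noncomputable def oddConj (p : ℕ) (u : ℂ) : ℂ := if Even p then u else conj u

theorem oddConj_mul (p : ℕ) (u v : ℂ) : oddConj p (u * v) = oddConj p u * oddConj p v := by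
  unfold oddConj
  split_ifs <;> simp

theorem oddConj_add (p : ℕ) (u v : ℂ) : oddConj p (u + v) = oddConj p u + oddConj p v := by
  unfold oddConj
  split_ifs <;> simp

theorem oddConj_oddConj (p : ℕ) (u : ℂ) : oddConj p (oddConj p u) = u := by
  unfold oddConj
  split_ifs <;> simp

theorem oddConj_ofReal (p : ℕ) (r : ℝ) : oddConj p r = r := by
  unfold oddConj
  split_ifs <;> simp

theorem oddConj_eq_zero {p : ℕ} {u : ℂ} : oddConj p u = 0 ↔ u = 0 := by
  unfold oddConj
  split_ifs <;> simp

theorem oddConj_re (p : ℕ) (u : ℂ) : (oddConj p u).re = u.re := by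
  unfold oddConj
  split_ifs <;> simp

theorem oddConj_im (p : ℕ) (u : ℂ) : (oddConj p u).im = (-1) ^ p * u.im := by
  unfold oddConj
  split_ifs with h
  · simp [h.neg_one_pow]
  · simp [(Nat.not_even_iff_odd.1 h).neg_one_pow]

theorem oddConj_circ (p : ℕ) (x : ℝ) : oddConj p (circ x) = circ ((-1) ^ p * x) := by
  unfold oddConj
  split_ifs with h
  · simp [h.neg_one_pow]
  · simp [(Nat.not_even_iff_odd.1 h).neg_one_pow, circ_neg]

theorem continuous_oddConj (p : ℕ) : Continuous (oddConj p) := by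
  unfold oddConj
  split_ifs
  · exact continuous_id
  · exact Complex.continuous_conj

/-- The parametrization of the contact plane at `w` by `ℂ`. -/
noncomputable def frameVec (p : ℕ) (w : ℂ × ℂ) (l : ℂ) : ℂ × ℂ :=
  -- Without the shears and for even p this is l(−conj w₂, conj w₁), which spans the standard
  -- contact structure; for odd p the second coordinate is conjugated. The shears rescale the
  -- angular parts so that `cutForm` cancels.
  (-shear (shearFactor p w.2) (l * oddConj p (conj w.2)) w.1,
    shear (shearFactor p w.1) (oddConj p (l * conj w.1)) w.2)

theorem frameVec_add (p : ℕ) (w : ℂ × ℂ) (l l' : ℂ) :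
    frameVec p w (l + l') = frameVec p w l + frameVec p w l' := by
  simp only [frameVec, add_mul, oddConj_add, shear_add, neg_add, Prod.mk_add_mk]

theorem frameVec_real_mul (p : ℕ) (w : ℂ × ℂ) (r : ℝ) (l : ℂ) :
    frameVec p w (r * l) = r • frameVec p w l := by
  simp only [frameVec, mul_assoc, oddConj_mul p r, oddConj_ofReal, shear_real_mul, Prod.smul_mk,
    smul_neg, Complex.real_smul]

theorem frameVec_eq (p : ℕ) (w : ℂ × ℂ) (l : ℂ) :
    frameVec p w l = l.re • frameVec p w 1 + l.im • frameVec p w Complex.I := by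
  rw [← frameVec_real_mul, ← frameVec_real_mul, ← frameVec_add, mul_one, Complex.re_add_im]

/-- The product of the parameter of `frameVec` with `conj w₁ conj w₂` or `conj w₁ w₂`. -/
noncomputable def frameCoord (p : ℕ) (w : ℂ × ℂ) (l : ℂ) : ℂ :=
  conj w.1 * (l * oddConj p (conj w.2))

theorem conj_mul_frameVec_fst (p : ℕ) (w : ℂ × ℂ) (l : ℂ) :
    conj w.1 * (frameVec p w l).1 = -(((frameCoord p w l).re : ℂ)
      + (shearFactor p w.2 * (frameCoord p w l).im : ℝ) * Complex.I) := by
  rw [frameVec, mul_neg, conj_mul_shear]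
  rfl

theorem conj_mul_frameVec_snd (p : ℕ) (w : ℂ × ℂ) (l : ℂ) :
    conj w.2 * (frameVec p w l).2 = ((frameCoord p w l).re : ℂ)
      + ((-1) ^ p * shearFactor p w.1 * (frameCoord p w l).im : ℝ) * Complex.I := by
  have h : conj w.2 * oddConj p (l * conj w.1) = oddConj p (frameCoord p w l) := by
    rw [frameCoord, oddConj_mul, oddConj_mul, oddConj_mul, oddConj_oddConj]
    ring
  rw [frameVec, conj_mul_shear, h, oddConj_re, oddConj_im, mul_left_comm, mul_assoc]

theorem cutForm_eq_shearFactor (p : ℕ) (w v : ℂ × ℂ) :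
    cutForm p w v = (2 * Real.pi)⁻¹ * ((-1) ^ p * shearFactor p w.1 * (conj w.1 * v.1).im
      + shearFactor p w.2 * (conj w.2 * v.2).im) := by
  have h := neg_one_pow_mul_self p
  unfold cutForm shearFactor
  linear_combination -(2 * Real.pi)⁻¹ * (angle p 1 * Real.sinc (angle p (‖w.1‖ ^ 2)))
    * (conj w.1 * v.1).im * h

theorem frameVec_mem (p : ℕ) (w : ℂ × ℂ) (l : ℂ) : frameVec p w l ∈ contactPlane p w := by
  constructor
  · unfold IsTangent
    rw [conj_mul_frameVec_fst, conj_mul_frameVec_snd]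
    simp only [Complex.neg_re, Complex.add_re, Complex.ofReal_re, Complex.mul_I_re,
      Complex.ofReal_im]
    ring
  · rw [cutForm_eq_shearFactor, conj_mul_frameVec_fst, conj_mul_frameVec_snd]
    refine mul_eq_zero_of_right _ ?_
    simp only [Complex.neg_im, Complex.add_im, Complex.ofReal_im, Complex.mul_I_im,
      Complex.ofReal_re]
    ring

/-! ### The frame vectors span the contact planes -/

theorem shearFactor_snd_eq_one {p : ℕ} {w : ℂ × ℂ} (hw : w ∈ S3) (h : w.1 = 0) :
    shearFactor p w.2 = 1 := by
  have hw' : ‖w.1‖ ^ 2 + ‖w.2‖ ^ 2 = 1 := hw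
  exact shearFactor_of_norm_sq_one (by simpa [h] using hw')

theorem shearFactor_fst_eq_one {p : ℕ} {w : ℂ × ℂ} (hw : w ∈ S3) (h : w.2 = 0) :
    shearFactor p w.1 = 1 := by
  have hw' : ‖w.1‖ ^ 2 + ‖w.2‖ ^ 2 = 1 := hw
  exact shearFactor_of_norm_sq_one (by simpa [h] using hw')

theorem continuousOn_frameVec (p : ℕ) (l : ℂ) : ContinuousOn (fun w => frameVec p w l) S3 := by
  rw [continuousOn_iff_continuous_domRestrict]
  have c1 : Continuous fun w : S3 => (w : ℂ × ℂ).1 := continuous_fst.comp continuous_subtype_val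
  have c2 : Continuous fun w : S3 => (w : ℂ × ℂ).2 := continuous_snd.comp continuous_subtype_val
  have k1 := Complex.continuous_conj.comp c1
  have k2 := Complex.continuous_conj.comp c2
  exact (continuous_shear ((continuous_shearFactor p).comp c2)
      (continuous_const.mul ((continuous_oddConj p).comp k2)) c1
      fun w h => shearFactor_snd_eq_one w.2 h).neg.prodMk
    (continuous_shear ((continuous_shearFactor p).comp c1)
      ((continuous_oddConj p).comp (continuous_const.mul k1)) c2
      fun w h => shearFactor_fst_eq_one w.2 h)

theorem shearFactor_cut_fst {p : ℕ} {x y z : ℝ} (h0 : 0 < z) :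
    (-1) ^ p * shearFactor p (cut (x, y, z)).1 = Real.sin (angle p z) / z := by
  rw [cut_eq, shearFactor_of_norm_sq h0.ne' (norm_sqrt_mul_circ h0.le x)]
  linear_combination Real.sin (angle p z) / z * neg_one_pow_mul_self p

theorem shearFactor_cut_snd {p : ℕ} {x y z : ℝ} (h1 : z < 1) :
    shearFactor p (cut (x, y, z)).2 = Real.cos (angle p z) / (1 - z) := by
  have h : 0 < 1 - z := by linarith
  rw [cut_eq, shearFactor_of_norm_sq h.ne' (norm_sqrt_mul_circ h.le y), sin_angle_one_sub]
  linear_combination Real.cos (angle p z) / (1 - z) * neg_one_pow_mul_self p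

theorem exists_cut_of_ne_zero {w : ℂ × ℂ} (hw : w ∈ S3) (h1 : w.1 ≠ 0) (h2 : w.2 ≠ 0) :
    ∃ x y z, 0 < z ∧ z < 1 ∧ cut (x, y, z) = w := by
  obtain ⟨x, y, z, hz0, hz1, rfl⟩ := cut_surjective w hw
  refine ⟨x, y, z, hz0.lt_of_ne fun h => h1 ?_, hz1.lt_of_ne fun h => h2 ?_, rfl⟩
  · simp [cut, ← h]
  · simp [cut, h]

theorem cut_ne_zero {x y z : ℝ} (h0 : 0 < z) (h1 : z < 1) :
    (cut (x, y, z)).1 ≠ 0 ∧ (cut (x, y, z)).2 ≠ 0 := by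
  have k1 := Real.sqrt_pos.2 h0
  have k2 := Real.sqrt_pos.2 (by linarith : 0 < 1 - z)
  exact ⟨mul_ne_zero (by exact_mod_cast k1.ne') (circ_ne_zero x),
    mul_ne_zero (by exact_mod_cast k2.ne') (circ_ne_zero y)⟩

/-- The two factors are multiples of sin and cos of the same angle, so they have no common zero. -/
theorem shearFactor_ne_zero {p : ℕ} {w : ℂ × ℂ} (hw : w ∈ S3) (h1 : w.1 ≠ 0) (h2 : w.2 ≠ 0)
    (k1 : shearFactor p w.1 = 0) (k2 : shearFactor p w.2 = 0) : False := by
  obtain ⟨x, y, z, hz0, hz1, rfl⟩ := exists_cut_of_ne_zero hw h1 h2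
  have e1 := shearFactor_cut_fst (p := p) (x := x) (y := y) hz0
  have e2 := shearFactor_cut_snd (p := p) (x := x) (y := y) hz1
  rw [k1, mul_zero, eq_comm, div_eq_zero_iff, or_iff_left hz0.ne'] at e1
  rw [k2, eq_comm, div_eq_zero_iff, or_iff_left (by linarith)] at e2
  have := Real.sin_sq_add_cos_sq (angle p z)
  rw [e1, e2] at this
  norm_num at this

theorem eq_frameVec {p : ℕ} {w v : ℂ × ℂ} {l : ℂ} (h1 : w.1 ≠ 0) (h2 : w.2 ≠ 0)
    (e1 : conj w.1 * v.1 = -(((frameCoord p w l).re : ℂ)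
      + (shearFactor p w.2 * (frameCoord p w l).im : ℝ) * Complex.I))
    (e2 : conj w.2 * v.2 = ((frameCoord p w l).re : ℂ)
      + ((-1) ^ p * shearFactor p w.1 * (frameCoord p w l).im : ℝ) * Complex.I) :
    v = frameVec p w l := by
  rw [← conj_mul_frameVec_fst] at e1
  rw [← conj_mul_frameVec_snd] at e2
  exact Prod.ext (mul_left_cancel₀ (by simpa using h1) e1)
    (mul_left_cancel₀ (by simpa using h2) e2)

theorem frameVec_eq_zero {p : ℕ} {w : ℂ × ℂ} (hw : w ∈ S3) {l : ℂ} (h : frameVec p w l = 0) :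
    l = 0 := by
  by_cases h1 : w.1 = 0
  · have h2 : w.2 ≠ 0 := fun h2 => by simp [S3, h1, h2] at hw
    have := congrArg Prod.fst h
    simp only [frameVec, shearFactor_snd_eq_one hw h1, shear_one, Prod.fst_zero, neg_eq_zero,
      mul_eq_zero, oddConj_eq_zero] at this
    simpa [h2] using this
  by_cases h2 : w.2 = 0
  · have := congrArg Prod.snd h
    simp only [frameVec, shearFactor_fst_eq_one hw h2, shear_one, Prod.snd_zero, oddConj_eq_zero,
      mul_eq_zero] at this
    simpa [h1] using this
  have e1 := conj_mul_frameVec_fst p w l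
  have e2 := conj_mul_frameVec_snd p w l
  rw [h] at e1 e2
  have hre : (frameCoord p w l).re = 0 := by simpa using (congrArg Complex.re e1).symm
  have him1 : shearFactor p w.2 = 0 ∨ (frameCoord p w l).im = 0 := by
    simpa using congrArg Complex.im e1
  have him2 : shearFactor p w.1 = 0 ∨ (frameCoord p w l).im = 0 := by
    have hκ0 : ((-1 : ℝ) ^ p) ≠ 0 := left_ne_zero_of_mul_eq_one (neg_one_pow_mul_self p)
    have := congrArg Complex.im e2
    simp only [Prod.snd_zero, mul_zero, Complex.zero_im, Complex.add_im, Complex.ofReal_im,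
      Complex.mul_I_im, Complex.ofReal_re, zero_add] at this
    simpa only [mul_eq_zero, hκ0, false_or] using this.symm
  have him : (frameCoord p w l).im = 0 := by
    by_contra hne
    exact shearFactor_ne_zero hw h1 h2 (him2.resolve_right hne) (him1.resolve_right hne)
  have : frameCoord p w l = 0 := Complex.ext hre him
  simpa [frameCoord, h1, h2, oddConj_eq_zero] using this

theorem linearIndependent_frameVec (p : ℕ) {w : ℂ × ℂ} (hw : w ∈ S3) :
    LinearIndependent ℝ ![frameVec p w 1, frameVec p w Complex.I] := by
  rw [LinearIndependent.pair_iff]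
  intro s t h
  have e := frameVec_eq p w ⟨s, t⟩
  rw [h] at e
  have := frameVec_eq_zero hw e
  exact ⟨congrArg Complex.re this, congrArg Complex.im this⟩

theorem exists_frameVec {p : ℕ} {w v : ℂ × ℂ} (hw : w ∈ S3) (hv : v ∈ contactPlane p w) :
    ∃ l, v = frameVec p w l := by
  obtain ⟨ht, hα⟩ := hv
  unfold IsTangent at ht
  have hpi : (2 * Real.pi)⁻¹ ≠ 0 := by
    have := Real.pi_pos
    positivity
  rw [cutForm_eq_shearFactor, mul_eq_zero, or_iff_right hpi] at hα
  by_cases h1 : w.1 = 0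
  · have h2 : w.2 ≠ 0 := fun h2 => by simp [S3, h1, h2] at hw
    have h2' : oddConj p (conj w.2) ≠ 0 := by simpa [oddConj_eq_zero] using h2
    rw [shearFactor_snd_eq_one hw h1, h1] at hα
    rw [h1] at ht
    have hv2 : conj w.2 * v.2 = 0 := Complex.ext (by simpa using ht) (by simpa using hα)
    have hv2' : v.2 = 0 := by simpa [h2] using hv2
    refine ⟨-v.1 / oddConj p (conj w.2), Prod.ext ?_ ?_⟩
    · simp only [frameVec, shearFactor_snd_eq_one hw h1, shear_one]
      field_simp
    · simp [frameVec, h1, hv2', oddConj_eq_zero.2 rfl, shear_zero_mid]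
  by_cases h2 : w.2 = 0
  · have h1' : conj w.1 ≠ 0 := by simpa using h1
    rw [shearFactor_fst_eq_one hw h2, h2] at hα
    rw [h2] at ht
    have hv1 : conj w.1 * v.1 = 0 := Complex.ext (by simpa using ht) (by simpa using hα)
    have hv1' : v.1 = 0 := by simpa [h1] using hv1
    refine ⟨oddConj p v.2 / conj w.1, Prod.ext ?_ ?_⟩
    · simp [frameVec, h2, hv1', oddConj_eq_zero.2 rfl, shear_zero_mid]
    · simp only [frameVec, shearFactor_fst_eq_one hw h2, shear_one]
      rw [div_mul_cancel₀ _ h1', oddConj_oddConj]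
  have hd : conj w.1 * oddConj p (conj w.2) ≠ 0 :=
    mul_ne_zero (by simpa using h1) (by simpa [oddConj_eq_zero] using h2)
  -- The angular parts are annihilated by a nonzero linear form in two variables, so they lie on the
  -- line spanned by the perpendicular vector.
  obtain ⟨s, hs1, hs2⟩ : ∃ s : ℝ, (conj w.1 * v.1).im = -(shearFactor p w.2 * s)
      ∧ (conj w.2 * v.2).im = (-1) ^ p * shearFactor p w.1 * s := by
    have hκ := neg_one_pow_mul_self p
    have hκ0 : ((-1 : ℝ) ^ p) ≠ 0 := left_ne_zero_of_mul_eq_one hκ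
    by_cases hb : shearFactor p w.2 = 0
    · have ha : shearFactor p w.1 ≠ 0 := fun ha => shearFactor_ne_zero hw h1 h2 ha hb
      refine ⟨(conj w.2 * v.2).im / ((-1) ^ p * shearFactor p w.1), ?_, ?_⟩
      · rw [hb, zero_mul, add_zero, mul_eq_zero, or_iff_right (mul_ne_zero hκ0 ha)] at hα
        rw [hα, hb, zero_mul, neg_zero]
      · field_simp
    · refine ⟨-(conj w.1 * v.1).im / shearFactor p w.2, ?_, ?_⟩
      · field_simp
      · field_simp
        linear_combination hα
  have hl : ∀ M : ℂ, frameCoord p w (M / (conj w.1 * oddConj p (conj w.2))) = M := fun M => by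
    rw [frameCoord, mul_left_comm, div_mul_cancel₀ _ hd]
  refine ⟨(⟨-(conj w.1 * v.1).re, s⟩ : ℂ) / (conj w.1 * oddConj p (conj w.2)), eq_frameVec h1 h2 ?_ ?_⟩
  · rw [hl, ← Complex.re_add_im (conj w.1 * v.1), hs1]
    push_cast
    simp only [Complex.add_re, Complex.ofReal_re, Complex.mul_I_re]
    simp
    ring
  · rw [hl, ← Complex.re_add_im (conj w.2 * v.2), hs2]
    have : (conj w.2 * v.2).re = -(conj w.1 * v.1).re := by linarith
    rw [this]

/-! ### Positivity -/

theorem conj_mul_fderiv_cut {x y z : ℝ} (h0 : 0 < z) (h1 : z < 1) (u : ℝ × ℝ × ℝ) :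
    conj (cut (x, y, z)).1 * (fderiv ℝ cut (x, y, z) u).1
        = ((u.2.2 / 2 : ℝ) : ℂ) + (2 * Real.pi * z * u.1 : ℝ) * Complex.I ∧
      conj (cut (x, y, z)).2 * (fderiv ℝ cut (x, y, z) u).2
        = ((-u.2.2 / 2 : ℝ) : ℂ) + (2 * Real.pi * (1 - z) * u.2.1 : ℝ) * Complex.I := by
  have h1' : 0 < 1 - z := by linarith
  have q1 : Real.sqrt z * Real.sqrt z = z := Real.mul_self_sqrt h0.le
  have q2 : Real.sqrt (1 - z) * Real.sqrt (1 - z) = 1 - z := Real.mul_self_sqrt h1'.le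
  have n1 := (Real.sqrt_pos.2 h0).ne'
  have n2 := (Real.sqrt_pos.2 h1').ne'
  rw [fderiv_cut x y z h0 h1 u]
  unfold cut
  simp only [conj_mul_polar]
  constructor
  · have k1 : Real.sqrt z * (u.2.2 / (2 * Real.sqrt z)) = u.2.2 / 2 := by field_simp
    have k2 : Real.sqrt z * (2 * Real.pi * Real.sqrt z * u.1) = 2 * Real.pi * z * u.1 := by
      linear_combination (2 * Real.pi * u.1) * q1
    rw [mul_add, ← mul_assoc, ← Complex.ofReal_mul, ← Complex.ofReal_mul, k1, k2]
  · have k1 : Real.sqrt (1 - z) * -(u.2.2 / (2 * Real.sqrt (1 - z))) = -u.2.2 / 2 := by field_simp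
    have k2 : Real.sqrt (1 - z) * (2 * Real.pi * Real.sqrt (1 - z) * u.2.1)
        = 2 * Real.pi * (1 - z) * u.2.1 := by
      linear_combination (2 * Real.pi * u.2.1) * q2
    rw [mul_add, ← mul_assoc, ← Complex.ofReal_neg, ← Complex.ofReal_mul, ← Complex.ofReal_mul,
      k1, k2]

/-- Positivity of a frame is only assumed for preimages under the differential of `cut`; this
supplies them. -/
theorem exists_fderiv_cut_eq {x y z : ℝ} (h0 : 0 < z) (h1 : z < 1) {v : ℂ × ℂ}
    (hv : IsTangent (cut (x, y, z)) v) : ∃ u, fderiv ℝ cut (x, y, z) u = v := by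
  have h1' : (1 - z : ℝ) ≠ 0 := by linarith
  have h0' := h0.ne'
  have hpi := Real.pi_ne_zero
  obtain ⟨n1, n2⟩ := cut_ne_zero (x := x) (y := y) h0 h1
  obtain ⟨e1, e2⟩ := conj_mul_fderiv_cut (x := x) (y := y) h0 h1
    ((conj (cut (x, y, z)).1 * v.1).im / (2 * Real.pi * z),
      (conj (cut (x, y, z)).2 * v.2).im / (2 * Real.pi * (1 - z)),
      2 * (conj (cut (x, y, z)).1 * v.1).re)
  refine ⟨_, Prod.ext (mul_left_cancel₀ (a := conj (cut (x, y, z)).1) (by simpa using n1)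
    (e1.trans ?_)) (mul_left_cancel₀ (a := conj (cut (x, y, z)).2) (by simpa using n2)
    (e2.trans ?_))⟩
  · refine Eq.trans ?_ (Complex.re_add_im (conj (cut (x, y, z)).1 * v.1))
    congr 3 <;> field_simp
  · have ht : (conj (cut (x, y, z)).2 * v.2).re = -(conj (cut (x, y, z)).1 * v.1).re := by
      unfold IsTangent at hv
      linarith
    refine Eq.trans ?_ (Complex.re_add_im (conj (cut (x, y, z)).2 * v.2))
    rw [ht]
    congr 3 <;> field_simp

/-- In the basis ∂_z, X_p the parameter l has coordinates given by negative multiples of the real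
and imaginary parts of l times a nonzero complex number, so l is an orientation-preserving
coordinate on the contact plane. -/
theorem dAlpha_frameVec {p : ℕ} {x y z : ℝ} (h0 : 0 < z) (h1 : z < 1) {l₁ l₂ : ℂ}
    {u₁ u₂ : ℝ × ℝ × ℝ}
    (e₁ : fderiv ℝ cut (x, y, z) u₁ = frameVec p (cut (x, y, z)) l₁)
    (e₂ : fderiv ℝ cut (x, y, z) u₂ = frameVec p (cut (x, y, z)) l₂) :
    0 < dAlpha p (x, y, z) u₁ u₂ ↔ 0 < (conj l₁ * l₂).im := by
  have h1' : 0 < 1 - z := by linarith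
  obtain ⟨n1, n2⟩ := cut_ne_zero (x := x) (y := y) h0 h1
  have coord : ∀ {u : ℝ × ℝ × ℝ} {l : ℂ},
      fderiv ℝ cut (x, y, z) u = frameVec p (cut (x, y, z)) l →
      u.2.2 = -2 * (frameCoord p (cut (x, y, z)) l).re ∧
      Real.cos (angle p z) * u.1 - Real.sin (angle p z) * u.2.1
        = -(frameCoord p (cut (x, y, z)) l).im / (2 * Real.pi * (z * (1 - z))) := by
    intro u l e
    obtain ⟨k1, k2⟩ := conj_mul_fderiv_cut (x := x) (y := y) h0 h1 u
    rw [e, conj_mul_frameVec_fst, shearFactor_cut_snd h1] at k1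
    rw [e, conj_mul_frameVec_snd, shearFactor_cut_fst h0] at k2
    have a1 := congrArg Complex.re k1
    have a2 := congrArg Complex.im k1
    have a3 := congrArg Complex.im k2
    simp only [Complex.neg_re, Complex.neg_im, Complex.add_re, Complex.add_im, Complex.ofReal_re,
      Complex.ofReal_im, Complex.mul_I_re, Complex.mul_I_im, neg_zero, add_zero, zero_add]
      at a1 a2 a3
    refine ⟨by linarith, ?_⟩
    have hcs := Real.sin_sq_add_cos_sq (angle p z)
    generalize Real.sin (angle p z) = S at *
    generalize Real.cos (angle p z) = C at *
    have hpi := Real.pi_ne_zero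
    have h0' := h0.ne'
    have h1'' := h1'.ne'
    field_simp at a2 a3 ⊢
    linear_combination -C * a2 + S * a3 - (frameCoord p (cut (x, y, z)) l).im * hcs
  obtain ⟨a₁, b₁⟩ := coord e₁
  obtain ⟨a₂, b₂⟩ := coord e₂
  have hd : dAlpha p (x, y, z) u₁ u₂ = angle p 1 / (Real.pi * (z * (1 - z)))
      * (conj (frameCoord p (cut (x, y, z)) l₁) * frameCoord p (cut (x, y, z)) l₂).im := by
    have : dAlpha p (x, y, z) u₁ u₂ = angle p 1 *
        (u₁.2.2 * (Real.cos (angle p z) * u₂.1 - Real.sin (angle p z) * u₂.2.1)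
        - u₂.2.2 * (Real.cos (angle p z) * u₁.1 - Real.sin (angle p z) * u₁.2.1)) := by
      unfold dAlpha
      ring
    rw [this, b₁, b₂, a₁, a₂]
    simp only [Complex.mul_im, Complex.conj_re, Complex.conj_im]
    have hpi := Real.pi_ne_zero
    have h0' := h0.ne'
    have h1'' := h1'.ne'
    field_simp
    ring
  have hm : (conj (frameCoord p (cut (x, y, z)) l₁) * frameCoord p (cut (x, y, z)) l₂).im
      = Complex.normSq (conj (cut (x, y, z)).1 * oddConj p (conj (cut (x, y, z)).2))
        * (conj l₁ * l₂).im := by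
    unfold frameCoord
    simp only [Complex.normSq_apply, Complex.mul_im, Complex.mul_re, map_mul, Complex.conj_re,
      Complex.conj_im, Complex.conj_conj]
    ring
  have hpos : 0 < Complex.normSq (conj (cut (x, y, z)).1 * oddConj p (conj (cut (x, y, z)).2)) :=
    Complex.normSq_pos.2 (mul_ne_zero (by simpa using n1) (by simpa [oddConj_eq_zero] using n2))
  have hc : 0 < angle p 1 / (Real.pi * (z * (1 - z))) := by
    have : 0 < angle p 1 := by
      unfold angle
      positivity
    positivity
  rw [hd, hm, mul_pos_iff_of_pos_left hc, mul_pos_iff_of_pos_left hpos]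

theorem isPositiveFrame_frameVec (p : ℕ) :
    IsPositiveFrame p (fun w => frameVec p w 1) (fun w => frameVec p w Complex.I) where
  continuousOn₁ := continuousOn_frameVec p 1
  continuousOn₂ := continuousOn_frameVec p Complex.I
  mem₁ w _ := frameVec_mem p w 1
  mem₂ w _ := frameVec_mem p w Complex.I
  independent _ hw := linearIndependent_frameVec p hw
  positive := by
    rintro ⟨x, y, z⟩ h0 h1 u₁ u₂ e₁ e₂
    exact (dAlpha_frameVec h0 h1 e₁ e₂).2 (by simp)

/-! ### The rotation number -/

/-- The surjection `(x, y, s) ↦ (sin s e^{2πix}, cos s e^{2πiy})` onto the sphere. -/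
noncomputable def sphereParam (q : ℝ × ℝ × ℝ) : ℂ × ℂ :=
  ((Real.sin q.2.2 : ℂ) * circ q.1, (Real.cos q.2.2 : ℂ) * circ q.2.1)

theorem continuous_sphereParam : Continuous sphereParam := by
  unfold sphereParam
  fun_prop

theorem sphereParam_mem (q : ℝ × ℝ × ℝ) : sphereParam q ∈ S3 := by
  simp only [S3, sphereParam, Set.mem_ofPred_eq, norm_mul, norm_circ, mul_one, Complex.norm_real,
    Real.norm_eq_abs, sq_abs, Real.sin_sq_add_cos_sq]

theorem exists_sphereParam {z : ℝ} (h0 : 0 ≤ z) (h1 : z ≤ 1) :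
    ∃ s, ∀ x y, sphereParam (x, y, s) = cut (x, y, z) := by
  have hs1 : Real.sqrt z ≤ 1 := Real.sqrt_le_one.2 h1
  refine ⟨Real.arcsin (Real.sqrt z), fun x y => ?_⟩
  rw [cut_eq, sphereParam, Real.cos_arcsin, Real.sq_sqrt h0,
    Real.sin_arcsin (by linarith [Real.sqrt_nonneg z]) hs1]

/-- A nonvanishing function on the sphere does not wind along a torus knot. -/
theorem hasWindingNumber_comp_torusKnot {α : ℂ × ℂ → ℂ}
    (hα : Continuous fun q => α (sphereParam q)) (h0 : ∀ q, α (sphereParam q) ≠ 0) (a b : ℤ)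
    {z : ℝ} (hz0 : 0 ≤ z) (hz1 : z ≤ 1) :
    HasWindingNumber (fun t => α (torusKnot a b z t)) 0 := by
  have per : ∀ (a b : ℤ) (s : ℝ),
      Function.Periodic (fun t : ℝ => α (sphereParam (a * t, b * t, s))) 1 := fun a b s t => by
    have h1 := periodic_circ_int_mul a t
    have h2 := periodic_circ_int_mul b t
    simp only at h1 h2
    simp only [sphereParam, h1, h2]
  have hom : ∀ (a b : ℤ) (s₀ s₁ : ℝ),
      HasWindingNumber (fun t : ℝ => α (sphereParam (a * t, b * t, s₀))) 0 →
      HasWindingNumber (fun t : ℝ => α (sphereParam (a * t, b * t, s₁))) 0 := fun a b s₀ s₁ h =>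
    HasWindingNumber.homotopy (H := fun s t => α (sphereParam (a * t, b * t, s)))
      (hα.comp (by fun_prop : Continuous fun q : ℝ × ℝ =>
        ((a : ℝ) * q.2, (b : ℝ) * q.2, q.1))) (fun s t => h0 _) (per a b) h s₁
  obtain ⟨s, hs⟩ := exists_sphereParam hz0 hz1
  -- At s = π/2 the second coordinate is zero, so the loop of type (0, b) is constant. At s = 0 the
  -- first coordinate is zero, so there type (0, b) may be exchanged for (a, b). Moving s in between
  -- contracts the knot.
  have h1 : HasWindingNumber (fun t : ℝ =>
      α (sphereParam ((0 : ℤ) * t, b * t, Real.pi / 2))) 0 := by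
    convert hasWindingNumber_const (h0 (0, 0, Real.pi / 2)) using 2 with t
    simp [sphereParam]
  have h2 := hom 0 b _ 0 h1
  have h3 : HasWindingNumber (fun t : ℝ => α (sphereParam (a * t, b * t, 0))) 0 := by
    convert h2 using 2 with t
    simp [sphereParam]
  have h4 := hom a b _ s h3
  simp only [hs] at h4
  exact h4

/-- The velocity of a Legendrian torus knot in the parametrization of the contact planes. -/
theorem deriv_torusKnot_eq_frameVec {p : ℕ} {a b : ℤ} {z k : ℝ} (h0 : 0 < z) (h1 : z < 1)
    (ha : (a : ℝ) = k * Real.cos (angle p z)) (hb : (b : ℝ) = -(k * Real.sin (angle p z)))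
    (t : ℝ) :
    deriv (torusKnot a b z) t = frameVec p (torusKnot a b z t)
      ((-(2 * Real.pi * k * (Real.sqrt z * Real.sqrt (1 - z))) : ℝ) * Complex.I
        * circ ((a + (-1) ^ p * b : ℤ) * t)) := by
  have h1' : 0 < 1 - z := by linarith
  obtain ⟨n1, n2⟩ := cut_ne_zero (x := a * t) (y := b * t) h0 h1
  have q1 : Real.sqrt z * Real.sqrt z = z := Real.mul_self_sqrt h0.le
  have q2 : Real.sqrt (1 - z) * Real.sqrt (1 - z) = 1 - z := Real.mul_self_sqrt h1'.le
  have hcoord : frameCoord p (torusKnot a b z t)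
      ((-(2 * Real.pi * k * (Real.sqrt z * Real.sqrt (1 - z))) : ℝ) * Complex.I
        * circ ((a + (-1) ^ p * b : ℤ) * t))
      = (-(2 * Real.pi * k * (z * (1 - z))) : ℝ) * Complex.I := by
    -- The phase of the parameter cancels those of conj w₁ and of the conjugated second coordinate;
    -- this is the source of a + (−1)^p b.
    have hc : circ ((a + (-1) ^ p * b : ℤ) * t) * circ (-(a * t)) * circ ((-1) ^ p * -(b * t))
        = 1 := by
      rw [← circ_add, ← circ_add, ← circ_zero]
      congr 1
      push_cast
      ring
    have q1' : (Real.sqrt z : ℂ) * Real.sqrt z = z := by exact_mod_cast q1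
    have q2' : (Real.sqrt (1 - z) : ℂ) * Real.sqrt (1 - z) = 1 - z := by exact_mod_cast q2
    rw [frameCoord, torusKnot_eq]
    simp only [map_mul, Complex.conj_ofReal, oddConj_mul, oddConj_ofReal, ← circ_neg, oddConj_circ]
    generalize circ ((a + (-1) ^ p * b : ℤ) * t) = c₀ at *
    generalize circ (-(a * t)) = c₁ at *
    generalize circ ((-1) ^ p * -(b * t)) = c₂ at *
    push_cast
    generalize (Real.sqrt z : ℂ) = r at *
    generalize (Real.sqrt (1 - z) : ℂ) = s at *
    rw [← q2', ← q1']
    linear_combination -(2 * Real.pi * k * (r * r * (s * s))) * Complex.I * hc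
  have s1 := shearFactor_cut_fst (p := p) (x := a * t) (y := b * t) h0
  have s2 := shearFactor_cut_snd (p := p) (x := a * t) (y := b * t) h1
  refine eq_frameVec n1 n2 ?_ ?_
  · rw [hcoord, conj_mul_deriv_torusKnot_fst a b h0.le, torusKnot, torusCurve, s2, Complex.mul_I_im,
      Complex.mul_I_re, Complex.ofReal_re, Complex.ofReal_im, neg_zero, Complex.ofReal_zero,
      zero_add, ← neg_mul, ← Complex.ofReal_neg, ha]
    congr 2
    have := h1'.ne'
    field_simp
  · rw [hcoord, conj_mul_deriv_torusKnot_snd a b h1.le, torusKnot, torusCurve, s1, Complex.mul_I_im,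
      Complex.mul_I_re, Complex.ofReal_re, Complex.ofReal_im, neg_zero, Complex.ofReal_zero,
      zero_add, hb]
    congr 2
    have := h0.ne'
    field_simp

/-- Cramer's rule for the real basis `(A, B)` of `ℂ`. -/
theorem eq_coeff_combination {A B D : ℂ} (h : (conj A * B).im ≠ 0) :
    D = ((((2 * (conj A * B).im)⁻¹ : ℝ) * (conj (A - Complex.I * B) * D
        - (A + Complex.I * B) * conj D)).re : ℂ) * A
      + ((((2 * (conj A * B).im)⁻¹ : ℝ) * (conj (A - Complex.I * B) * D
        - (A + Complex.I * B) * conj D)).im : ℂ) * B := by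
  have hδ : A.re * B.im - A.im * B.re = (conj A * B).im := by
    simp
    ring
  generalize (conj A * B).im = δ at *
  rw [Complex.re_ofReal_mul, Complex.im_ofReal_mul]
  apply Complex.ext
  · simp only [Complex.add_re, Complex.ofReal_re, Complex.ofReal_im, Complex.sub_re, Complex.sub_im, Complex.mul_re,
      Complex.mul_im, Complex.conj_re, Complex.conj_im, Complex.I_re, Complex.I_im, Complex.add_im]
    field_simp
    linear_combination (-2 * D.re) * hδ
  · simp only [Complex.add_im, Complex.ofReal_re, Complex.ofReal_im, Complex.sub_re, Complex.sub_im, Complex.mul_re,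
      Complex.mul_im, Complex.conj_re, Complex.conj_im, Complex.I_re, Complex.I_im, Complex.add_re]
    field_simp
    linear_combination (-2 * D.im) * hδ

/-- Let l₁, l₂ be the parameters of the given frame and c that of the velocity. By Cramer the
coefficient is (2δ)⁻¹(conj(l₁ − il₂)c − (l₁ + il₂)conj c). Since δ > 0 the first term dominates, and
conj(l₁ − il₂) does not wind along the knot. -/
theorem hasRotationNumber_torusKnot {p : ℕ} {a b : ℤ} {z k : ℝ} (h0 : 0 < z) (h1 : z < 1)
    (hk : k ≠ 0) (ha : (a : ℝ) = k * Real.cos (angle p z))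
    (hb : (b : ℝ) = -(k * Real.sin (angle p z))) :
    HasRotationNumber p (torusKnot a b z) (a + (-1) ^ p * b) := by
  refine ⟨⟨_, _, isPositiveFrame_frameVec p⟩, fun Y₁ Y₂ hY => ?_⟩
  choose! l₁ hl₁ using fun w hw => exists_frameVec hw (hY.mem₁ w hw)
  choose! l₂ hl₂ using fun w hw => exists_frameVec hw (hY.mem₂ w hw)
  have pull : ∀ {Y : ℂ × ℂ → ℂ × ℂ}, ContinuousOn Y S3 →
      Continuous fun q => Y (sphereParam q) := fun h =>
    h.comp_continuous continuous_sphereParam sphereParam_mem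
  have coeff : ∀ {Y : ℂ × ℂ → ℂ × ℂ} {l : ℂ × ℂ → ℂ}, ContinuousOn Y S3 →
      (∀ w ∈ S3, Y w = frameVec p w (l w)) → Continuous fun q => l (sphereParam q) := by
    intro Y l hc hl
    obtain ⟨c1, c2⟩ := continuous_coeff_prod (x := fun q => (l (sphereParam q)).re)
      (y := fun q => (l (sphereParam q)).im) (pull (continuousOn_frameVec p 1))
      (pull (continuousOn_frameVec p Complex.I)) (pull hc)
      (fun q => linearIndependent_frameVec p (sphereParam_mem q))
      (fun q => by rw [hl _ (sphereParam_mem q), frameVec_eq])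
    have : (fun q => l (sphereParam q)) = fun q => ((l (sphereParam q)).re : ℂ)
        + ((l (sphereParam q)).im : ℂ) * Complex.I := funext fun q => (Complex.re_add_im _).symm
    rw [this]
    fun_prop
  have c₁ := coeff hY.continuousOn₁ hl₁
  have c₂ := coeff hY.continuousOn₂ hl₂
  set δ : ℂ × ℂ → ℝ := fun w => (conj (l₁ w) * l₂ w).im with hδ
  have hδc : Continuous fun q => δ (sphereParam q) :=
    Complex.continuous_im.comp ((Complex.continuous_conj.comp c₁).mul c₂)
  have hδ0 : ∀ w ∈ S3, δ w ≠ 0 := by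
    intro w hw h
    -- If the imaginary part vanishes, this is an explicit real linear relation between l₁ and l₂,
    -- and `frameVec` transports it to the frame.
    have key : ((-(conj (l₁ w) * l₂ w).re : ℝ) : ℂ) * l₁ w
        + (Complex.normSq (l₁ w) : ℝ) * l₂ w = 0 := by
      have e : ((conj (l₁ w) * l₂ w).re : ℂ) = conj (l₁ w) * l₂ w := by
        conv_rhs => rw [← Complex.re_add_im (conj (l₁ w) * l₂ w)]
        change (conj (l₁ w) * l₂ w).im = 0 at h
        rw [h]
        simp
      rw [Complex.ofReal_neg, e, Complex.normSq_eq_conj_mul_self]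
      ring
    have k2 := congrArg (frameVec p w) key
    rw [frameVec_add, frameVec_real_mul, frameVec_real_mul, ← hl₁ w hw, ← hl₂ w hw] at k2
    have hz : frameVec p w 0 = 0 := by
      have := frameVec_real_mul p w 0 0
      simpa using this
    rw [hz] at k2
    have k3 := (LinearIndependent.pair_iff.1 (hY.independent w hw) _ _ k2).2
    have k4 : l₁ w = 0 := Complex.normSq_eq_zero.1 k3
    have k5 : Y₁ w ≠ 0 := (hY.independent w hw).ne_zero 0
    rw [hl₁ w hw, k4, hz] at k5
    exact k5 rfl
  have hδcut : ∀ x y, 0 < δ (cut (x, y, z)) := by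
    intro x y
    have hw := cut_mem x y z h0.le h1.le
    obtain ⟨u₁, hu₁⟩ := exists_fderiv_cut_eq h0 h1 (hY.mem₁ _ hw).1
    obtain ⟨u₂, hu₂⟩ := exists_fderiv_cut_eq h0 h1 (hY.mem₂ _ hw).1
    have hpos := hY.positive (x, y, z) h0 h1 u₁ u₂ hu₁ hu₂
    rw [hl₁ _ hw] at hu₁
    rw [hl₂ _ hw] at hu₂
    exact (dAlpha_frameVec h0 h1 hu₁ hu₂).1 hpos
  -- Pulled back to the connected parameter space, δ is continuous without zeros, so its sign on one
  -- torus holds everywhere.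
  have hδpos : ∀ q, 0 < δ (sphereParam q) := by
    intro q
    by_contra hcon
    obtain ⟨s, hs⟩ := exists_sphereParam h0.le h1.le
    have : (0 : ℝ) ∈ Set.range fun q => δ (sphereParam q) :=
      mem_range_of_exists_le_of_exists_ge hδc ⟨q, not_lt.1 hcon⟩
        ⟨(0, 0, s), by rw [hs]; exact (hδcut 0 0).le⟩
    obtain ⟨q', hq'⟩ := this
    exact hδ0 _ (sphereParam_mem q') hq'
  have hlt : ∀ q, ‖l₁ (sphereParam q) + Complex.I * l₂ (sphereParam q)‖
      < ‖l₁ (sphereParam q) - Complex.I * l₂ (sphereParam q)‖ := by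
    intro q
    rw [← sq_lt_sq₀ (norm_nonneg _) (norm_nonneg _), ← Complex.normSq_eq_norm_sq,
      ← Complex.normSq_eq_norm_sq]
    have hpos := hδpos q
    have : Complex.normSq (l₁ (sphereParam q) - Complex.I * l₂ (sphereParam q))
        - Complex.normSq (l₁ (sphereParam q) + Complex.I * l₂ (sphereParam q))
        = 4 * δ (sphereParam q) := by
      simp [hδ, Complex.normSq_apply]
      ring
    linarith
  have hα := (hasWindingNumber_comp_torusKnot (α := fun w => l₁ w - Complex.I * l₂ w)
    (c₁.sub (continuous_const.mul c₂))
    (fun q => norm_pos_iff.1 ((norm_nonneg _).trans_lt (hlt q))) a b h0.le h1.le).conj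
  obtain ⟨s, hs⟩ := exists_sphereParam h0.le h1.le
  have hknot : ∀ t, torusKnot a b z t = sphereParam (a * t, b * t, s) := fun t => (hs _ _).symm
  have comp : ∀ {X : Type} [TopologicalSpace X] {g : ℂ × ℂ → X},
      Continuous (fun q => g (sphereParam q)) → Continuous fun t => g (torusKnot a b z t) := by
    intro X _ g hg
    simp only [hknot]
    exact hg.comp (by fun_prop : Continuous fun t : ℝ => ((a : ℝ) * t, (b : ℝ) * t, s))
  have d₁ := comp c₁
  have d₂ := comp c₂
  have hper := periodic_torusKnot a b z
  set C : ℂ := (-(2 * Real.pi * k * (Real.sqrt z * Real.sqrt (1 - z))) : ℝ) * Complex.I with hC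
  have hC0 : C ≠ 0 := by
    have e1 := (Real.sqrt_pos.2 h0).ne'
    have e2 := (Real.sqrt_pos.2 (by linarith : 0 < 1 - z)).ne'
    have hpi := Real.pi_ne_zero
    refine mul_ne_zero (Complex.ofReal_ne_zero.2 (neg_ne_zero.2 ?_)) Complex.I_ne_zero
    positivity
  set c : ℝ → ℂ := fun t => C * circ ((a + (-1) ^ p * b : ℤ) * t) with hc
  have hcc : Continuous c := by fun_prop
  have hcper : Function.Periodic c 1 := fun t => by
    have := periodic_circ_int_mul (a + (-1) ^ p * b) t
    simp only at this
    simp only [hc, this]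
  have hcw : HasWindingNumber c (a + (-1) ^ p * b) := (hasWindingNumber_circ _).const_mul hC0
  set m₁ : ℝ → ℂ := fun t => l₁ (torusKnot a b z t) with hm₁
  set m₂ : ℝ → ℂ := fun t => l₂ (torusKnot a b z t) with hm₂
  have hmper : ∀ t, m₁ (t + 1) = m₁ t ∧ m₂ (t + 1) = m₂ t := fun t => by
    simp only [hm₁, hm₂, hper t, and_self]
  have hbase : HasWindingNumber (fun t => conj (m₁ t - Complex.I * m₂ t) * c t)
      (a + (-1) ^ p * b) := by
    have := hα.mul hcw
    rwa [neg_zero, zero_add] at this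
  have conjc : ∀ {f : ℝ → ℂ}, Continuous f → Continuous fun t => conj (f t) := fun h =>
    Complex.continuous_conj.comp h
  have hmain : HasWindingNumber (fun t => conj (m₁ t - Complex.I * m₂ t) * c t
      - (m₁ t + Complex.I * m₂ t) * conj (c t)) (a + (-1) ^ p * b) := by
    have ca : Continuous fun t => conj (m₁ t - Complex.I * m₂ t) * c t :=
      (conjc (d₁.sub (continuous_const.mul d₂))).mul hcc
    have cb : Continuous fun t => (m₁ t + Complex.I * m₂ t) * conj (c t) :=
      (d₁.add (continuous_const.mul d₂)).mul (conjc hcc)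
    refine hbase.of_norm_sub_lt ca (ca.sub cb)
      (fun t => by simp only [(hmper t).1, (hmper t).2, hcper t])
      (fun t => by simp only [(hmper t).1, (hmper t).2, hcper t]) fun t => ?_
    rw [sub_sub_cancel_left, norm_neg, norm_mul, norm_mul, RCLike.norm_conj, RCLike.norm_conj]
    have h := hlt (a * t, b * t, s)
    rw [hs] at h
    exact mul_lt_mul_of_pos_right h (norm_pos_iff.2 (hcw.choose_spec.2.1 t))
  refine ⟨fun t => ((2 * δ (torusKnot a b z t))⁻¹ : ℝ) * (conj (m₁ t - Complex.I * m₂ t) * c t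
      - (m₁ t + Complex.I * m₂ t) * conj (c t)), fun t => ?_,
    hmain.pos_mul fun t => inv_pos.2 (mul_pos two_pos (hδcut _ _))⟩
  have hw : torusKnot a b z t ∈ S3 := cut_mem _ _ _ h0.le h1.le
  have hδt : δ (torusKnot a b z t) ≠ 0 := (hδcut _ _).ne'
  beta_reduce
  rw [deriv_torusKnot_eq_frameVec h0 h1 ha hb, hl₁ _ hw, hl₂ _ hw, ← frameVec_real_mul,
    ← frameVec_real_mul, ← frameVec_add]
  congr 1
  change c t = _ * m₁ t + _ * m₂ t
  exact eq_coeff_combination hδt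

end ContactCut

/-! ### Both orientations of the knot -/

theorem mainTheorem7 (p : ℕ) (a b : ℤ) (hab : IsCoprime a b) (z : ℝ) (hz0 : 0 < z) (hz1 : z < 1)
    (hslope : HasSlope p z a b) (ε : ℤ) (hε : ε = 1 ∨ ε = -1) :
    IsLegendrianKnot p (torusKnot (ε * a) (ε * b) z) ∧
    HasThurstonBennequin p (torusKnot (ε * a) (ε * b) z) (a * b) ∧
    HasRotationNumber p (torusKnot (ε * a) (ε * b) z) (ε * (a + (-1) ^ p * b)) ∧
    RotatesRelativeTo (deriv (torusCurve (ε * a) (ε * b) z))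
      (fun t => frame₁ p (torusCurve (ε * a) (ε * b) z t))
      (fun t => frame₂ p (torusCurve (ε * a) (ε * b) z t)) (ε * (a + (-1) ^ p * b)) := by
  obtain ⟨k, hk, ha, hb⟩ := hslope.exists_smul hab
  have hεε : ε * ε = 1 := by rcases hε with rfl | rfl <;> norm_num
  have hε0 : (ε : ℝ) ≠ 0 := by exact_mod_cast left_ne_zero_of_mul_eq_one hεε
  have hab' : IsCoprime (ε * a) (ε * b) := by
    obtain ⟨u, v, huv⟩ := hab
    exact ⟨ε * u, ε * v, by linear_combination (u * a + v * b) * hεε + huv⟩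
  have ha' : ((ε * a : ℤ) : ℝ) = ε * k * Real.cos (angle p z) := by
    push_cast
    rw [ha]
    ring
  have hb' : ((ε * b : ℤ) : ℝ) = -(ε * k * Real.sin (angle p z)) := by
    push_cast
    rw [hb]
    ring
  -- Reversing the knot replaces (a, b, k) by ε(a, b, k), so the same lemmas apply; ε cancels in the
  -- product ab and survives in the rotation number.
  have hk' := mul_ne_zero hε0 hk
  have htb : ε * a * (ε * b) = a * b := by linear_combination a * b * hεε
  have hrot : ε * a + (-1) ^ p * (ε * b) = ε * (a + (-1) ^ p * b) := by ring
  rw [← htb, ← hrot]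
  refine ⟨isLegendrianKnot_torusKnot hab' hz0 hz1 ?_,
    hasThurstonBennequin_torusKnot hab' hz0 hz1 hk' ha' hb',
    hasRotationNumber_torusKnot hz0 hz1 hk' ha' hb', rotatesRelativeTo_frame hk' ha' hb'⟩
  rw [ha', hb']
  ring
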